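/- Let $\mathfrak g$ be a finite-dimensional semisimple Lie algebra over $\mathbb C$, and let $R(\mathfrak g)$ be its representation ring, whose additive group is the free abelian group on the finite-dimensional representations modulo the relations $[U]=[U']+[U'']$ whenever $U\cong U'\oplus U''$. Write $cl(U)\in R(\mathfrak g)$ for the class of a representation $U$. For $S\in R(\mathfrak g)$ write $S\ge 0$ if $S$ is a finite sum of classes of irreducible representations with non-negative integer coefficients, and write $S\le T$ if $T-S\ge 0$. Let $V_1,\dots,V_k$ be pairwise non-isomorphic irreducible finite-dimensional representations of $\mathfrak g$, and let $V$ and $W$ be finite-dimensional representations with $$cl(V)=\sum_{i=1}^k n_i\,cl(V_i),\qquad cl(W)=\sum_{i=1}^k m_i\,cl(V_i)\qquad (n_i,m_i\in\mathbb N_0).$$ Let $s=\sum_{i=1}^k s_i\,cl(V_i)$ with $s_i\in\mathbb Z$ and suppose that $0\le s\le\min(cl(V),cl(W))$, that is, $0\le s$, $s\le cl(V)$ and $s\le cl(W)$. In the finite-dimensional complex vector space $\hom_{\mathfrak g}(V,W)$ of $\mathfrak g$-morphisms $V\to W$, consider the $\mathfrak g$-determinantal variety $$\hom_{\mathfrak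 g}(V,W)_s=\{f\in\hom_{\mathfrak g}(V,W)\;:\;cl(\operatorname{im} f)=s\}.$$ Then $\hom_{\mathfrak g}(V,W)_s$ is locally closed in the Zariski topology, irreducible (in particular non-empty) and smooth (at each of its points the Zariski tangent space has the local dimension of the variety as its dimension), and $$\dim\hom_{\mathfrak g}(V,W)_s=\sum_{i=1}^k(n_i+m_i-s_i)\,s_i .$$ Moreover, it is a product of ordinary determinantal varieties: there is a linear isomorphism $\hom_{\mathfrak g}(V,W)\cong\prod_{i=1}^k\hom(\mathbb C^{n_i},\mathbb C^{m_i})$ that maps $\hom_{\mathfrak g}(V,W)_s$ onto $\prod_{i=1}^k\hom(\mathbb C^{n_i},\mathbb C^{m_i})_{s_i}$, where $\hom(\mathbb C^{n},\mathbb C^{m})_{r}$ denotes the set of linear maps of rank exactly $r$. -/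

import Mathlib

universe u v

/-! ### Classical (quasi-affine) varieties in a finite-dimensional complex vector space -/

noncomputable section

namespace Zar

variable (E : Type*) [AddCommGroup E] [Module ℂ E]

/-- The algebra of polynomial functions on `E`: it is generated by the linear functionals. -/
def polyFun : Subalgebra ℂ (E → ℂ) :=
  Algebra.adjoin ℂ (Set.range fun φ : Module.Dual ℂ E => (φ : E → ℂ))

/-- The Zariski topology on `E`, generated by the principal open sets
`{x | f x ≠ 0}` of the polynomial functions `f`. -/
@[reducible] def zariski : TopologicalSpace E :=
  TopologicalSpace.generateFrom {U | ∃ f ∈ polyFun E, U = {x | f x ≠ 0}}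

variable {E}

/-- `X` is locally closed for the Zariski topology, that is, a quasi-affine variety. -/
def IsLocClosed (X : Set E) : Prop := @IsLocallyClosed E (zariski E) X

/-- `X` is irreducible (in particular non-empty) for the Zariski topology. -/
def IsIrred (X : Set E) : Prop := @IsIrreducible E (zariski E) X

/-- The dimension of `X`: the Krull dimension of `X` with the topology induced by the
Zariski topology. -/
def dim (X : Set E) : WithBot ℕ∞ :=
  @topologicalKrullDim X (@instTopologicalSpaceSubtype E (· ∈ X) (zariski E))

/-- The local dimension of `X` at `p`: the least dimension of a Zariski open neighbourhood of `p`
in `X`. -/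
def localDim (X : Set E) (p : E) : WithBot ℕ∞ :=
  ⨅ (U : Set E) (_ : @IsOpen E (zariski E) U ∧ p ∈ U), dim (X ∩ U)

/-- A polynomial function has at every point a differential, which is a linear functional. -/
lemma exists_differential {f : E → ℂ} (hf : f ∈ polyFun E) (p : E) :
    ∃ L : Module.Dual ℂ E, ∀ w : E, HasDerivAt (fun t : ℂ => f (p + t • w)) (L w) 0 := by
  induction hf using Algebra.adjoin_induction with
  | mem f hf =>
    obtain ⟨φ, rfl⟩ := hf
    refine ⟨φ, fun w => ?_⟩
    have h : HasDerivAt (fun t : ℂ => φ p + t * φ w) (1 * φ w) 0 :=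
      ((hasDerivAt_id (0 : ℂ)).mul_const (φ w)).const_add (φ p)
    simpa using h
  | algebraMap c =>
    exact ⟨0, fun w => by simpa using hasDerivAt_const (0 : ℂ) c⟩
  | add f g _ _ hf hg =>
    obtain ⟨L, hL⟩ := hf
    obtain ⟨M, hM⟩ := hg
    exact ⟨L + M, fun w => (hL w).add (hM w)⟩
  | mul f g _ _ hf hg =>
    obtain ⟨L, hL⟩ := hf
    obtain ⟨M, hM⟩ := hg
    refine ⟨g p • L + f p • M, fun w => ?_⟩
    have h : HasDerivAt (fun t : ℂ => f (p + t • w) * g (p + t • w))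
        (L w * g (p + (0 : ℂ) • w) + f (p + (0 : ℂ) • w) * M w) 0 := (hL w).mul (hM w)
    rw [zero_smul, add_zero] at h
    have e : (g p • L + f p • M) w = L w * g p + f p * M w := by
      simp [mul_comm]
    rw [e]
    exact h

/-- The Zariski tangent space of `X` at `p`: the vectors that are killed by the differential at `p`
of every polynomial function vanishing on `X`. -/
def tangentSpace (X : Set E) (p : E) : Submodule ℂ E where
  carrier := {w | ∀ f ∈ polyFun E, (∀ x ∈ X, f x = 0) →
    deriv (fun t : ℂ => f (p + t • w)) 0 = 0}
  zero_mem' := by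
    intro f _ _
    simp
  add_mem' := by
    intro a b ha hb f hf hX
    obtain ⟨L, hL⟩ := exists_differential hf p
    have h1 := ha f hf hX
    have h2 := hb f hf hX
    rw [(hL _).deriv] at h1 h2 ⊢
    rw [map_add, h1, h2, add_zero]
  smul_mem' := by
    intro c a ha f hf hX
    obtain ⟨L, hL⟩ := exists_differential hf p
    have h1 := ha f hf hX
    rw [(hL _).deriv] at h1 ⊢
    rw [map_smul, h1, smul_zero]

/-- `X` is smooth: at each of its points the Zariski tangent space has the local dimension of `X`
as its dimension. -/
def IsSmooth (X : Set E) : Prop :=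
  ∀ p ∈ X, ((Module.finrank ℂ (tangentSpace X p) : ℕ) : WithBot ℕ∞) = localDim X p

end Zar

/-! ### Finite-dimensional representations and their classes -/

/-- A finite-dimensional representation of the complex Lie algebra `𝔤`. -/
structure LieRep (𝔤 : Type u) [LieRing 𝔤] [LieAlgebra ℂ 𝔤] where
  carrier : Type v
  [addCommGroup : AddCommGroup carrier]
  [module : Module ℂ carrier]
  [lieRingModule : LieRingModule 𝔤 carrier]
  [lieModule : LieModule ℂ 𝔤 carrier]
  [finiteDimensional : FiniteDimensional ℂ carrier]

attribute [instance] LieRep.addCommGroup LieRep.module LieRep.lieRingModule LieRep.lieModule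
  LieRep.finiteDimensional

/-- `U ≅ V ⊕ W` as representations. -/
def LieRep.IsSum {𝔤 : Type u} [LieRing 𝔤] [LieAlgebra ℂ 𝔤] (U V W : LieRep.{u, v} 𝔤) : Prop :=
  ∃ e : U.carrier ≃ₗ[ℂ] V.carrier × W.carrier,
    ∀ (x : 𝔤) (a : U.carrier), e ⁅x, a⁆ = (⁅x, (e a).1⁆, ⁅x, (e a).2⁆)

/-- The (additive group of the) ring `R(𝔤)` of finite-dimensional representations: the free abelian
group on the representations modulo `[U] = [V] + [W]` whenever `U ≅ V ⊕ W`. (With `W = 0` this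
identifies isomorphic representations.) -/
def RepRing (𝔤 : Type u) [LieRing 𝔤] [LieAlgebra ℂ 𝔤] : Type (max u (v + 1)) :=
  FreeAbelianGroup (LieRep.{u, v} 𝔤) ⧸ AddSubgroup.closure
    {z | ∃ U V W : LieRep.{u, v} 𝔤, LieRep.IsSum U V W ∧
      z = FreeAbelianGroup.of U - (FreeAbelianGroup.of V + FreeAbelianGroup.of W)}

instance (𝔤 : Type u) [LieRing 𝔤] [LieAlgebra ℂ 𝔤] : AddCommGroup (RepRing.{u, v} 𝔤) :=
  inferInstanceAs (AddCommGroup (FreeAbelianGroup (LieRep.{u, v} 𝔤) ⧸ AddSubgroup.closure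
    {z | ∃ U V W : LieRep.{u, v} 𝔤, LieRep.IsSum U V W ∧
      z = FreeAbelianGroup.of U - (FreeAbelianGroup.of V + FreeAbelianGroup.of W)}))

section

variable (𝔤 : Type u) [LieRing 𝔤] [LieAlgebra ℂ 𝔤]

/-- The class `cl(V) ∈ R(𝔤)` of a finite-dimensional representation `V`. -/
def cl (V : Type v) [AddCommGroup V] [Module ℂ V] [LieRingModule 𝔤 V] [LieModule ℂ 𝔤 V]
    [FiniteDimensional ℂ V] : RepRing.{u, v} 𝔤 :=
  QuotientAddGroup.mk (FreeAbelianGroup.of (LieRep.mk V))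

variable {𝔤}

/-- `S ≥ 0`: the element `S` is a finite sum, with non-negative integer coefficients, of classes of
irreducible representations. -/
def RepRing.Nonneg (S : RepRing.{u, v} 𝔤) : Prop :=
  S ∈ AddSubmonoid.closure
    {T | ∃ V : LieRep.{u, v} 𝔤, LieModule.IsIrreducible ℂ 𝔤 V.carrier ∧ T = cl 𝔤 V.carrier}

/-- `S₁ ≤ S₂` means `S₂ - S₁ ≥ 0`. -/
instance : LE (RepRing.{u, v} 𝔤) := ⟨fun S₁ S₂ => RepRing.Nonneg (S₂ - S₁)⟩

variable {V W : Type v}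
  [AddCommGroup V] [Module ℂ V] [LieRingModule 𝔤 V] [LieModule ℂ 𝔤 V] [FiniteDimensional ℂ V]
  [AddCommGroup W] [Module ℂ W] [LieRingModule 𝔤 W] [LieModule ℂ 𝔤 W] [FiniteDimensional ℂ W]

/-- The `𝔤`-rank of a morphism: the class of its image. -/
def gRank (f : V →ₗ⁅ℂ, 𝔤⁆ W) : RepRing.{u, v} 𝔤 := cl 𝔤 f.range

variable (V W)

/-- The `𝔤`-determinantal variety `hom_𝔤(V, W)_s`, in the vector space `hom_𝔤(V, W)`. -/
def homRank (s : RepRing.{u, v} 𝔤) : Set (V →ₗ⁅ℂ, 𝔤⁆ W) := {f | gRank f = s}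

end

/-- The determinantal variety `hom(ℂ^n, ℂ^m)_r` of linear maps of rank exactly `r`. -/
def detVariety (n m : ℕ) (r : ℤ) : Set ((Fin n → ℂ) →ₗ[ℂ] (Fin m → ℂ)) :=
  {f | (Module.finrank ℂ (LinearMap.range f) : ℤ) = r}

end

/-! A morphism `f : V → W` acts by composition on the multiplicity spaces, giving linear maps `f_i :
hom(X i, V) → hom(X i, W)`. By Schur's lemma the additive function `U ↦ dim hom(X i, U)` on the
representation ring reads off the coefficient of `cl (X i)`, so these spaces have dimensions `n i`
and `m i`. The images of the `X i` span `V`, so `f ↦ (f_i)` is injective, and a dimension count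
makes it a linear isomorphism (`exists_equiv_homRank`). The multiplicity of `X i` in `im f` is the
rank of `f_i` (`finrank_range_postcomp`). Hence the variety is a product of sets of matrices of
fixed rank.

It remains to study the `m × n` matrices of rank `r`. If `a x b` is an invertible `r × r` matrix and
`x` has rank `r`, then `x = (x b)(a x b)⁻¹(a x)`. So `x ↦ (x b, a x)` is a chart onto a principal
open subset of the space of pairs `(y, z)` with `a y = z b`, which has dimension `m r + r n - r²`
(`chartRankSet`). Charts give the dimension, the local dimensions and the tangent spaces.
Irreducibility follows by joining any two points by a polynomial curve that leaves the set at
finitely many parameters only (`curveConnected_rankSet`). Local closedness holds because `r ≤ rank`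
is an open condition. All of this passes to products and through linear isomorphisms. -/

set_option linter.unusedSectionVars false

/-! ### Polynomial maps, the Zariski topology and irreducibility -/

namespace Zar

open TopologicalSpace Topology

section

attribute [local instance] zariski

variable {E F G : Type*} [AddCommGroup E] [Module ℂ E] [AddCommGroup F] [Module ℂ F]
  [AddCommGroup G] [Module ℂ G]

lemma dual_mem_polyFun (φ : Module.Dual ℂ E) : (fun x => φ x) ∈ polyFun E :=
  Algebra.subset_adjoin ⟨φ, rfl⟩

lemma const_mem_polyFun (c : ℂ) : (fun _ : E => c) ∈ polyFun E :=
  (polyFun E).algebraMap_mem c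

lemma isOpen_ne {f : E → ℂ} (hf : f ∈ polyFun E) : IsOpen {x | f x ≠ 0} :=
  isOpen_generateFrom_of_mem ⟨f, hf, rfl⟩

lemma isClosed_eq_zero {f : E → ℂ} (hf : f ∈ polyFun E) : IsClosed {x | f x = 0} := by
  rw [← isOpen_compl_iff]
  exact isOpen_ne hf

/-- The principal open sets form a basis of the Zariski topology. -/
lemma exists_ne_of_isOpen {U : Set E} (hU : IsOpen U) :
    ∀ x ∈ U, ∃ f ∈ polyFun E, f x ≠ 0 ∧ ∀ y, f y ≠ 0 → y ∈ U := by
  induction hU with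
  | basic s hs =>
    obtain ⟨f, hf, rfl⟩ := hs
    exact fun x hx => ⟨f, hf, hx, fun y hy => hy⟩
  | univ => exact fun x _ => ⟨_, const_mem_polyFun 1, one_ne_zero, fun _ _ => trivial⟩
  | inter s t _ _ hs ht =>
    rintro x ⟨h1, h2⟩
    obtain ⟨f, hf, hfx, hfs⟩ := hs x h1
    obtain ⟨g, hg, hgx, hgs⟩ := ht x h2
    exact ⟨f * g, mul_mem hf hg, mul_ne_zero hfx hgx, fun y hy =>
      ⟨hfs y (left_ne_zero_of_mul hy), hgs y (right_ne_zero_of_mul hy)⟩⟩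
  | sUnion S _ ih =>
    rintro x ⟨s, hs, hx⟩
    obtain ⟨f, hf, hfx, hfs⟩ := ih s hs x hx
    exact ⟨f, hf, hfx, fun y hy => ⟨s, hs, hfs y hy⟩⟩

/-- A map between vector spaces that is polynomial in coordinates. -/
def IsPolyMap (g : E → F) : Prop := ∀ φ : Module.Dual ℂ F, (fun x => φ (g x)) ∈ polyFun E

lemma IsPolyMap.comp_mem {g : E → F} (hg : IsPolyMap g) {f : F → ℂ} (hf : f ∈ polyFun F) :
    (fun x => f (g x)) ∈ polyFun E := by
  induction hf using Algebra.adjoin_induction with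
  | mem f hf =>
    obtain ⟨φ, rfl⟩ := hf
    exact hg φ
  | algebraMap c => exact const_mem_polyFun c
  | add f f' _ _ hf hf' => exact add_mem hf hf'
  | mul f f' _ _ hf hf' => exact mul_mem hf hf'

lemma IsPolyMap.comp {g : F → G} {f : E → F} (hg : IsPolyMap g) (hf : IsPolyMap f) :
    IsPolyMap fun x => g (f x) :=
  fun φ => hf.comp_mem (hg φ)

lemma _root_.LinearMap.isPolyMap (L : E →ₗ[ℂ] F) : IsPolyMap fun x => L x :=
  fun φ => dual_mem_polyFun (φ ∘ₗ L)

lemma isPolyMap_const (c : F) : IsPolyMap fun _ : E => c :=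
  fun φ => const_mem_polyFun (φ c)

lemma isPolyMap_id : IsPolyMap fun x : E => x := dual_mem_polyFun

lemma IsPolyMap.add {f g : E → F} (hf : IsPolyMap f) (hg : IsPolyMap g) :
    IsPolyMap fun x => f x + g x := by
  intro φ
  simp only [map_add]
  exact add_mem (hf φ) (hg φ)

lemma IsPolyMap.smul {f : E → ℂ} {g : E → F} (hf : f ∈ polyFun E) (hg : IsPolyMap g) :
    IsPolyMap fun x => f x • g x := by
  intro φ
  simp only [map_smul, smul_eq_mul]
  exact mul_mem hf (hg φ)

lemma IsPolyMap.sum {ι : Type*} (s : Finset ι) {f : ι → E → F} (hf : ∀ i ∈ s, IsPolyMap (f i)) :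
    IsPolyMap fun x => ∑ i ∈ s, f i x := by
  intro φ
  have h := sum_mem (S := polyFun E) (fun i hi => hf i hi φ)
  convert h using 1
  ext x
  simp

lemma isPolyMap_pi {ι : Type*} [Finite ι] {M : ι → Type*} [∀ i, AddCommGroup (M i)]
    [∀ i, Module ℂ (M i)] {f : ∀ i, E → M i} (hf : ∀ i, IsPolyMap (f i)) :
    IsPolyMap fun x i => f i x := by
  classical
  have := Fintype.ofFinite ι
  have : (fun x i => f i x) = fun x => ∑ i, LinearMap.single ℂ M i (f i x) := by
    ext x j
    simp [Finset.sum_apply]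
  rw [this]
  exact IsPolyMap.sum _ fun i _ => (LinearMap.isPolyMap _).comp (hf i)

lemma IsPolyMap.continuous {g : E → F} (hg : IsPolyMap g) : Continuous g := by
  refine continuous_generateFrom_iff.2 ?_
  rintro _ ⟨f, hf, rfl⟩
  exact isOpen_ne (hg.comp_mem hf)

/-- A polynomial function on the line is given by a polynomial. -/
lemma exists_polynomial {f : ℂ → ℂ} (hf : f ∈ polyFun ℂ) :
    ∃ P : Polynomial ℂ, ∀ t, f t = P.eval t := by
  induction hf using Algebra.adjoin_induction with
  | mem f hf =>
    obtain ⟨φ, rfl⟩ := hf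
    refine ⟨Polynomial.C (φ 1) * Polynomial.X, fun t => ?_⟩
    have h : φ (t • 1) = t • φ 1 := φ.map_smul t 1
    rw [smul_eq_mul, smul_eq_mul, mul_one] at h
    rw [Polynomial.eval_mul, Polynomial.eval_C, Polynomial.eval_X, mul_comm]
    exact h
  | algebraMap c => exact ⟨Polynomial.C c, fun t => by simp⟩
  | add f g _ _ hf hg =>
    obtain ⟨P, hP⟩ := hf
    obtain ⟨Q, hQ⟩ := hg
    exact ⟨P + Q, fun t => by simp [hP, hQ]⟩
  | mul f g _ _ hf hg =>
    obtain ⟨P, hP⟩ := hf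
    obtain ⟨Q, hQ⟩ := hg
    exact ⟨P * Q, fun t => by simp [hP, hQ]⟩

lemma finite_zeros {f : ℂ → ℂ} (hf : f ∈ polyFun ℂ) {t₀ : ℂ} (h : f t₀ ≠ 0) :
    {t | f t = 0}.Finite := by
  obtain ⟨P, hP⟩ := exists_polynomial hf
  have hP0 : P ≠ 0 := by
    rintro rfl
    simp [hP] at h
  refine (Polynomial.finite_setOfPred_isRoot hP0).subset fun t ht => ?_
  simpa [hP] using ht

/-- Any two points of `X` are joined by a polynomial curve that lies in `X`
up to finitely many parameters. -/
def CurveConnected (X : Set E) : Prop := ∀ p ∈ X, ∀ q ∈ X, ∃ c : ℂ → E, IsPolyMap c ∧ c 0 = p ∧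
  c 1 = q ∧ ∃ D ∈ polyFun ℂ, D 0 ≠ 0 ∧ ∀ t, D t ≠ 0 → c t ∈ X

/-- A curve from a point of one open set to a point of another misses each of them for finitely many
parameters only, since a nonzero polynomial in one variable has finitely many roots. As `ℂ` is
infinite, some parameter lands in both open sets and in `X`. -/
lemma CurveConnected.isPreirreducible {X : Set E} (hX : CurveConnected X) :
    IsPreirreducible X := by
  rintro U U' hU hU' ⟨p, hp, hpU⟩ ⟨q, hq, hqU⟩
  obtain ⟨f, hf, hfp, hfU⟩ := exists_ne_of_isOpen hU p hpU
  obtain ⟨g, hg, hgq, hgU⟩ := exists_ne_of_isOpen hU' q hqU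
  obtain ⟨c, hc, c0, c1, D, hD, hD0, hDX⟩ := hX p hp q hq
  have h1 := finite_zeros (hc.comp_mem hf) (t₀ := 0) (by rwa [c0])
  have h2 := finite_zeros (hc.comp_mem hg) (t₀ := 1) (by rwa [c1])
  have h3 := finite_zeros hD hD0
  obtain ⟨t, ht⟩ := ((h1.union h2).union h3).infinite_compl.nonempty
  simp only [Set.mem_compl_iff, Set.mem_union, Set.mem_ofPred_eq, not_or] at ht
  exact ⟨c t, hDX t ht.2, hfU _ ht.1.1, hgU _ ht.1.2⟩

lemma CurveConnected.comap {X : Set F} (hX : CurveConnected X) (e : E ≃ₗ[ℂ] F) :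
    CurveConnected (e ⁻¹' X) := by
  intro p hp q hq
  obtain ⟨c, hc, c0, c1, D, hD, hD0, hDX⟩ := hX _ hp _ hq
  refine ⟨fun t => e.symm (c t), (LinearMap.isPolyMap e.symm.toLinearMap).comp hc, by simp [c0],
    by simp [c1], D, hD, hD0, fun t ht => ?_⟩
  simpa using hDX t ht

lemma CurveConnected.pi {ι : Type*} [Finite ι] {M : ι → Type*} [∀ i, AddCommGroup (M i)]
    [∀ i, Module ℂ (M i)] {X : ∀ i, Set (M i)} (hX : ∀ i, CurveConnected (X i)) :
    CurveConnected (Set.univ.pi X) := by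
  have := Fintype.ofFinite ι
  intro p hp q hq
  choose c hc c0 c1 D hD hD0 hDX using fun i => hX i (p i) (hp i trivial) (q i) (hq i trivial)
  refine ⟨fun t i => c i t, isPolyMap_pi hc, funext c0, funext c1, ∏ i, D i,
    prod_mem fun i _ => hD i, ?_, fun t ht i _ => hDX i t ?_⟩
  · simpa [Finset.prod_apply, Finset.prod_eq_zero_iff] using hD0
  · simp only [Finset.prod_apply, ne_eq, Finset.prod_eq_zero_iff, not_exists] at ht
    exact fun h => ht i ⟨Finset.mem_univ _, h⟩

/-! ### Krull dimension of a vector space and of its open subsets -/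

lemma isPolyMap_line (p v : E) : IsPolyMap fun t : ℂ => p + t • v :=
  (isPolyMap_const p).add (IsPolyMap.smul (dual_mem_polyFun LinearMap.id) (isPolyMap_const v))

lemma isPreirreducible_affine (p : E) (K : Submodule ℂ E) :
    IsPreirreducible {x | x - p ∈ K} := by
  refine CurveConnected.isPreirreducible fun x hx y hy => ⟨fun t => x + t • (y - x),
    isPolyMap_line _ _, by simp, by simp, _, const_mem_polyFun 1, one_ne_zero, fun t _ => ?_⟩
  have h : x + t • (y - x) - p = (x - p) + t • ((y - p) - (x - p)) := by
    module
  change _ ∈ K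
  rw [h]
  exact K.add_mem hx (K.smul_mem _ (K.sub_mem hy hx))

lemma isClosed_affine [FiniteDimensional ℂ E] (p : E) (K : Submodule ℂ E) :
    IsClosed {x | x - p ∈ K} := by
  have : {x | x - p ∈ K} = ⋂ φ ∈ K.dualAnnihilator, {x | φ x - φ p = 0} := by
    ext x
    have := Subspace.forall_mem_dualAnnihilator_apply_eq_zero_iff K (x - p)
    simp only [map_sub] at this
    simp [← this]
  rw [this]
  exact isClosed_biInter fun φ _ =>
    isClosed_eq_zero (sub_mem (dual_mem_polyFun φ) (const_mem_polyFun _))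

lemma mem_of_isClosed {Z : Set E} (hZ : IsClosed Z) {x : E}
    (hx : ∀ f ∈ polyFun E, (∀ z ∈ Z, f z = 0) → f x = 0) : x ∈ Z := by
  by_contra h
  obtain ⟨f, hf, hfx, hfZ⟩ := exists_ne_of_isOpen hZ.isOpen_compl x h
  exact hfx (hx f hf fun z hz => by_contra fun h0 => hfZ z h0 hz)

/-- The ideal of the polynomial functions vanishing on an irreducible closed set. -/
def vanishingIdeal (Z : IrreducibleCloseds E) : Ideal (polyFun E) where
  carrier := {f | ∀ z ∈ Z, (f : E → ℂ) z = 0}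
  zero_mem' := fun _ _ => rfl
  add_mem' := fun {f g} hf hg z hz => by simp [hf z hz, hg z hz]
  smul_mem' := fun f g hg z hz => by simp [hg z hz]

lemma isPrime_vanishingIdeal (Z : IrreducibleCloseds E) : (vanishingIdeal Z).IsPrime where
  ne_top' := by
    intro h
    obtain ⟨z, hz⟩ := Z.isIrreducible.nonempty
    have h1 : (1 : polyFun E) ∈ vanishingIdeal Z := h ▸ Submodule.mem_top
    exact one_ne_zero (h1 z hz)
  mem_or_mem' := by
    intro f g hfg
    by_contra! h
    obtain ⟨hf, hg⟩ := h
    simp only [vanishingIdeal, Submodule.mem_mk, AddSubmonoid.mem_mk, AddSubsemigroup.mem_mk,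
      Set.mem_ofPred_eq, not_forall] at hf hg
    obtain ⟨x, hx, hfx⟩ := hf
    obtain ⟨y, hy, hgy⟩ := hg
    obtain ⟨z, hz, h1, h2⟩ := Z.isIrreducible.isPreirreducible _ _ (isOpen_ne f.2) (isOpen_ne g.2)
      ⟨x, hx, hfx⟩ ⟨y, hy, hgy⟩
    exact mul_ne_zero h1 h2 (hfg z hz)

/-- The coordinates of a basis generate `polyFun E`, which is therefore a quotient of a polynomial
ring in `finrank ℂ E` variables. -/
lemma ringKrullDim_polyFun_le [FiniteDimensional ℂ E] :
    ringKrullDim (polyFun E) ≤ (Module.finrank ℂ E : WithBot ℕ∞) := by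
  let b := Module.finBasis ℂ E
  let ev : MvPolynomial (Fin (Module.finrank ℂ E)) ℂ →ₐ[ℂ] polyFun E :=
    MvPolynomial.aeval fun i => ⟨fun x => b.coord i x, dual_mem_polyFun _⟩
  have hX (i) : ev (MvPolynomial.X i) = ⟨fun x => b.coord i x, dual_mem_polyFun _⟩ :=
    MvPolynomial.aeval_X _ _
  have hev : Function.Surjective ev := by
    have h : polyFun E ≤ (ev.range.map (polyFun E).val) := by
      refine Algebra.adjoin_le ?_
      rintro _ ⟨φ, rfl⟩
      refine ⟨_, ⟨∑ i, MvPolynomial.C (φ (b i)) * MvPolynomial.X i, rfl⟩, ?_⟩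
      ext x
      have h1 : φ x = ∑ i, b.repr x i * φ (b i) := by
        conv_lhs => rw [← b.sum_repr x]
        simp only [map_sum, map_smul, smul_eq_mul]
      change ((ev _ : polyFun E) : E → ℂ) x = φ x
      rw [h1]
      simp [map_sum, hX, Finset.sum_apply, ← MvPolynomial.algebraMap_eq, mul_comm]
    rintro ⟨f, hf⟩
    obtain ⟨g, ⟨P, hP⟩, hg⟩ := h hf
    exact ⟨P, Subtype.ext ((congrArg Subtype.val hP).trans hg)⟩
  refine (ringKrullDim_le_of_surjective ev.toRingHom hev).trans ?_
  rw [MvPolynomial.ringKrullDim_of_isNoetherianRing]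
  simp

/-- Passing to vanishing ideals turns chains of irreducible closed sets into reversed chains of
primes. Strictness survives because a closed set is recovered from the functions vanishing on it. -/
lemma topologicalKrullDim_le_finrank [FiniteDimensional ℂ E] :
    topologicalKrullDim E ≤ (Module.finrank ℂ E : WithBot ℕ∞) := by
  refine le_trans ?_ (ringKrullDim_polyFun_le (E := E))
  rw [topologicalKrullDim, ringKrullDim, ← Order.krullDim_orderDual (α := PrimeSpectrum _)]
  refine Order.krullDim_le_of_strictMono
    (fun Z => OrderDual.toDual ⟨vanishingIdeal Z, isPrime_vanishingIdeal Z⟩) fun Z Z' h => ?_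
  refine OrderDual.toDual_lt_toDual.2 (lt_of_le_not_ge (fun f hf z hz => hf z (h.le hz)) ?_)
  intro h'
  exact h.not_ge fun x hx => mem_of_isClosed Z.isClosed fun f hf hfZ =>
    h' (show (⟨f, hf⟩ : polyFun E) ∈ vanishingIdeal Z from hfZ) x hx

/-- A full flag of affine subspaces through a point `p` of `O`, intersected with `O`, is a chain of
length `finrank ℂ E`. -/
lemma finrank_le_topologicalKrullDim [FiniteDimensional ℂ E] {O : Set E} (hO : IsOpen O)
    (hne : O.Nonempty) : (Module.finrank ℂ E : WithBot ℕ∞) ≤ topologicalKrullDim O := by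
  obtain ⟨p, hp⟩ := hne
  let b := Module.finBasis ℂ E
  let d := Module.finrank ℂ E
  -- `K j` is the span of the basis vectors with index below `j`.
  let K : ℕ → Submodule ℂ E := fun j => ⨅ i : Fin d, ⨅ _ : j ≤ i, LinearMap.ker (b.coord i)
  have hK (j : ℕ) (x : E) : x ∈ K j ↔ ∀ i : Fin d, j ≤ i → b.coord i x = 0 := by
    simp [K, Submodule.mem_iInf]
  have hemb : IsOpenEmbedding (Subtype.val : O → E) := hO.isOpenEmbedding_subtypeVal
  let C : Fin (d + 1) → IrreducibleCloseds O := fun j =>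
    { carrier := Subtype.val ⁻¹' {x | x - p ∈ K j}
      isIrreducible' := ⟨⟨⟨p, hp⟩, by simp⟩, (isPreirreducible_affine p (K j)).preimage hemb⟩
      isClosed' := (isClosed_affine p (K j)).preimage continuous_subtype_val }
  have hC : StrictMono C := by
    rw [Fin.strictMono_iff_lt_succ]
    intro j
    refine lt_of_le_not_ge (fun x hx => ?_) fun h => ?_
    · exact (hK _ _).2 fun i hi => (hK _ _).1 hx i ((Nat.le_succ _).trans hi)
    -- The line `p + t • b j` stays in `O` for all but finitely many `t`; any such `t ≠ 0` gives a
    -- point of the larger member of the flag outside the smaller one.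
    · obtain ⟨f, hf, hfp, hfO⟩ := exists_ne_of_isOpen hO p hp
      have hfin := finite_zeros ((isPolyMap_line p (b j)).comp_mem hf) (t₀ := 0) (by simpa using hfp)
      obtain ⟨t, ht⟩ := (hfin.union (Set.finite_singleton 0)).infinite_compl.nonempty
      simp only [Set.mem_compl_iff, Set.mem_union, Set.mem_ofPred_eq, Set.mem_singleton_iff,
        not_or] at ht
      have h1 : (⟨p + t • b j, hfO _ ht.1⟩ : O) ∈ C j.succ := by
        refine (hK _ _).2 fun i hi => ?_
        have hij : j ≠ i := by
          rintro rfl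
          simp at hi
        simp [hij]
      have h2 := (hK _ _).1 (h h1) j le_rfl
      simp [ht.2] at h2
  exact Order.LTSeries.length_le_krullDim (LTSeries.mk d C hC)

end

end Zar

/-! ### Algebraic charts and the dimension they compute -/

namespace Zar

open TopologicalSpace Topology

section

attribute [local instance] zariski

variable {E F : Type*} [AddCommGroup E] [Module ℂ E] [AddCommGroup F] [Module ℂ F]

/-- An algebraic chart of `X` around `p`: a linear projection `proj` to `F` that restricts to an
isomorphism from the part of `X` where `den ∘ proj` does not vanish to the principal open set
`den ≠ 0` of `F`; the inverse `inv` is the quotient of the polynomial map `num`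
by `den`. -/
structure Chart (X : Set E) (p : E) (F : Type*) [AddCommGroup F] [Module ℂ F] where
  proj : E →ₗ[ℂ] F
  den : F → ℂ
  num : F → E
  inv : F → E
  den_mem : den ∈ polyFun F
  isPolyMap : IsPolyMap num
  den_smul_inv : ∀ y, den y ≠ 0 → den y • inv y = num y
  den_ne_zero : den (proj p) ≠ 0
  inv_mem : ∀ y, den y ≠ 0 → inv y ∈ X
  proj_inv : ∀ y, den y ≠ 0 → proj (inv y) = y
  inv_proj : ∀ x ∈ X, den (proj x) ≠ 0 → inv (proj x) = x

namespace Chart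

variable {X : Set E} {p : E}

def comap {E' : Type*} [AddCommGroup E'] [Module ℂ E'] (e : E' ≃ₗ[ℂ] E) {p : E'}
    (C : Chart X (e p) F) : Chart (e ⁻¹' X) p F where
  proj := C.proj ∘ₗ e.toLinearMap
  den := C.den
  num y := e.symm (C.num y)
  inv y := e.symm (C.inv y)
  den_mem := C.den_mem
  isPolyMap := (LinearMap.isPolyMap e.symm.toLinearMap).comp C.isPolyMap
  den_smul_inv y hy := by rw [← map_smul, C.den_smul_inv y hy]
  den_ne_zero := C.den_ne_zero
  inv_mem y hy := by simpa using C.inv_mem y hy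
  proj_inv y hy := by simpa using C.proj_inv y hy
  inv_proj x hx h := by
    rw [LinearEquiv.symm_apply_eq]
    exact C.inv_proj (e x) hx h

def congr {F' : Type*} [AddCommGroup F'] [Module ℂ F'] (C : Chart X p F) (e : F ≃ₗ[ℂ] F') :
    Chart X p F' where
  proj := e.toLinearMap ∘ₗ C.proj
  den y := C.den (e.symm y)
  num y := C.num (e.symm y)
  inv y := C.inv (e.symm y)
  den_mem := (LinearMap.isPolyMap e.symm.toLinearMap).comp_mem C.den_mem
  isPolyMap := C.isPolyMap.comp (LinearMap.isPolyMap e.symm.toLinearMap)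
  den_smul_inv y hy := C.den_smul_inv _ hy
  den_ne_zero := by simpa using C.den_ne_zero
  inv_mem y hy := C.inv_mem _ hy
  proj_inv y hy := by simp [C.proj_inv _ hy]
  inv_proj x hx h := by
    simp only [LinearMap.comp_apply, LinearEquiv.coe_coe, LinearEquiv.symm_apply_apply] at h ⊢
    exact C.inv_proj x hx h

def pi {ι : Type*} [Fintype ι] [DecidableEq ι] {M N : ι → Type*} [∀ i, AddCommGroup (M i)]
    [∀ i, Module ℂ (M i)] [∀ i, AddCommGroup (N i)] [∀ i, Module ℂ (N i)]
    {X : ∀ i, Set (M i)} {p : ∀ i, M i} (C : ∀ i, Chart (X i) (p i) (N i)) :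
    Chart (Set.univ.pi X) p (∀ i, N i) where
  proj := LinearMap.pi fun i => (C i).proj ∘ₗ LinearMap.proj i
  den y := ∏ i, (C i).den (y i)
  -- The common denominator is the product of all `den`, so each numerator acquires the denominators
  -- of the other factors.
  num y i := (∏ j ∈ Finset.univ.erase i, (C j).den (y j)) • (C i).num (y i)
  inv y i := (C i).inv (y i)
  den_mem := by
    have h : ∀ i, (fun y : ∀ i, N i => (C i).den (y i)) ∈ polyFun (∀ i, N i) := fun i =>
      (LinearMap.isPolyMap (LinearMap.proj i)).comp_mem (C i).den_mem
    have h1 := prod_mem (t := Finset.univ) fun i _ => h i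
    convert h1 using 1
    ext y
    rw [Finset.prod_apply]
  isPolyMap := by
    refine isPolyMap_pi fun i => IsPolyMap.smul ?_
      ((C i).isPolyMap.comp (LinearMap.isPolyMap (LinearMap.proj (R := ℂ) (φ := N) i)))
    have h : ∀ i, (fun y : ∀ i, N i => (C i).den (y i)) ∈ polyFun (∀ i, N i) := fun i =>
      (LinearMap.isPolyMap (LinearMap.proj i)).comp_mem (C i).den_mem
    have h1 := prod_mem (t := Finset.univ.erase i) fun i _ => h i
    convert h1 using 1
    ext y
    rw [Finset.prod_apply]
  den_smul_inv y hy := funext fun i => by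
    rw [← (C i).den_smul_inv _ (Finset.prod_ne_zero_iff.1 hy i (Finset.mem_univ i)), smul_smul,
      Finset.prod_erase_mul _ _ (Finset.mem_univ i)]
    rfl
  den_ne_zero := Finset.prod_ne_zero_iff.2 fun i _ => (C i).den_ne_zero
  inv_mem y hy i _ := (C i).inv_mem _ (Finset.prod_ne_zero_iff.1 hy i (Finset.mem_univ i))
  proj_inv y hy := funext fun i =>
    (C i).proj_inv _ (Finset.prod_ne_zero_iff.1 hy i (Finset.mem_univ i))
  inv_proj x hx h := funext fun i =>
    (C i).inv_proj _ (hx i trivial) (Finset.prod_ne_zero_iff.1 h i (Finset.mem_univ i))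

/-- Clearing denominators: this makes `f ∘ inv` comparable with polynomial functions on `F`, which
is what continuity of `inv` requires. -/
lemma exists_pow_mul (C : Chart X p F) {f : E → ℂ} (hf : f ∈ polyFun E) :
    ∃ N : ℕ, ∃ g ∈ polyFun F, ∀ y, C.den y ≠ 0 → C.den y ^ N * f (C.inv y) = g y := by
  induction hf using Algebra.adjoin_induction with
  | mem f hf =>
    obtain ⟨φ, rfl⟩ := hf
    exact ⟨1, _, C.isPolyMap φ, fun y hy => by simp [← C.den_smul_inv y hy]⟩
  | algebraMap c => exact ⟨0, _, const_mem_polyFun c, fun y _ => by simp⟩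
  | add f f' _ _ hf hf' =>
    obtain ⟨N, g, hg, h⟩ := hf
    obtain ⟨N', g', hg', h'⟩ := hf'
    refine ⟨N + N', _, add_mem (mul_mem (pow_mem C.den_mem N') hg)
      (mul_mem (pow_mem C.den_mem N) hg'), fun y hy => ?_⟩
    simp only [Pi.add_apply, Pi.mul_apply, Pi.pow_apply, ← h y hy, ← h' y hy]
    ring
  | mul f f' _ _ hf hf' =>
    obtain ⟨N, g, hg, h⟩ := hf
    obtain ⟨N', g', hg', h'⟩ := hf'
    refine ⟨N + N', _, mul_mem hg hg', fun y hy => ?_⟩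
    simp only [Pi.mul_apply, ← h y hy, ← h' y hy]
    ring

lemma isOpen_den (C : Chart X p F) : IsOpen {y | C.den y ≠ 0} := isOpen_ne C.den_mem

lemma continuous_inv (C : Chart X p F) : Continuous fun y : {y | C.den y ≠ 0} => C.inv y := by
  refine continuous_generateFrom_iff.2 ?_
  rintro _ ⟨f, hf, rfl⟩
  obtain ⟨N, g, hg, h⟩ := C.exists_pow_mul hf
  convert (isOpen_ne hg).preimage (continuous_subtype_val (p := (· ∈ {y | C.den y ≠ 0}))) using 1
  ext ⟨y, hy⟩
  simp only [Set.mem_preimage, Set.mem_ofPred_eq, ← h y hy]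
  exact ⟨fun h => mul_ne_zero (pow_ne_zero _ hy) h, right_ne_zero_of_mul⟩

/-- The domain of the chart in the ambient space. -/
def domain (C : Chart X p F) : Set E := {x | C.den (C.proj x) ≠ 0}

lemma isOpen_domain (C : Chart X p F) : IsOpen C.domain :=
  isOpen_ne ((LinearMap.isPolyMap C.proj).comp_mem C.den_mem)

/-- On the domain, `inv` is a continuous left inverse of `proj`. Krull dimension does not increase
when passing to the source of an inducing map, so this bounds dimensions by that of `F`. -/
lemma isInducing_proj (C : Chart X p F) :
    IsInducing fun x : (X ∩ C.domain : Set E) => C.proj x := by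
  have h1 : Continuous fun x : (X ∩ C.domain : Set E) =>
      (⟨C.proj x, x.2.2⟩ : {y | C.den y ≠ 0}) :=
    ((LinearMap.isPolyMap C.proj).continuous.comp continuous_subtype_val).subtype_mk _
  have h2 : IsInducing fun x : (X ∩ C.domain : Set E) =>
      (⟨C.proj x, x.2.2⟩ : {y | C.den y ≠ 0}) := by
    refine .of_comp h1 C.continuous_inv ?_
    convert IsInducing.subtypeVal (t := X ∩ C.domain) using 1
    ext x
    exact C.inv_proj x x.2.1 x.2.2
  exact IsInducing.subtypeVal.comp h2

variable [FiniteDimensional ℂ F]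

lemma dim_inter_domain_le (C : Chart X p F) {Y : Set E} (hY : Y ⊆ X ∩ C.domain) :
    dim Y ≤ (Module.finrank ℂ F : WithBot ℕ∞) := by
  refine le_trans ?_ (topologicalKrullDim_le_finrank (E := F))
  exact (C.isInducing_proj.comp (IsEmbedding.inclusion hY).isInducing).topologicalKrullDim_le

/-- Here `inv` embeds a nonempty open subset of `F` into `X ∩ U`. The bound is needed for every `U`,
since `localDim` is an infimum over neighbourhoods. -/
lemma le_dim_inter (C : Chart X p F) (hp : p ∈ X) {U : Set E} (hU : IsOpen U) (hpU : p ∈ U) :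
    (Module.finrank ℂ F : WithBot ℕ∞) ≤ dim (X ∩ U) := by
  let O : Set F := Subtype.val '' ((fun y : {y | C.den y ≠ 0} => C.inv y) ⁻¹' U)
  have hO : IsOpen O := C.isOpen_den.isOpenMap_subtype_val _ (hU.preimage C.continuous_inv)
  have hO1 : ∀ y ∈ O, C.den y ≠ 0 ∧ C.inv y ∈ U := by
    rintro _ ⟨⟨y, hy⟩, h, rfl⟩
    exact ⟨hy, h⟩
  have hne : O.Nonempty := by
    refine ⟨C.proj p, ⟨C.proj p, C.den_ne_zero⟩, ?_, rfl⟩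
    simpa [C.inv_proj p hp C.den_ne_zero] using hpU
  refine (finrank_le_topologicalKrullDim hO hne).trans ?_
  let j : O → (X ∩ U : Set E) := fun y => ⟨C.inv y, C.inv_mem y (hO1 y y.2).1, (hO1 y y.2).2⟩
  have hj : Continuous j := by
    refine Continuous.subtype_mk ?_ _
    exact C.continuous_inv.comp (continuous_inclusion fun y hy => (hO1 y hy).1)
  have : IsInducing j := by
    refine .of_comp hj
      ((LinearMap.isPolyMap C.proj).continuous.comp continuous_subtype_val) ?_
    convert IsInducing.subtypeVal (t := O) using 1
    ext y
    exact C.proj_inv y (hO1 y y.2).1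
  exact this.topologicalKrullDim_le

lemma localDim_eq (C : Chart X p F) (hp : p ∈ X) :
    localDim X p = (Module.finrank ℂ F : WithBot ℕ∞) := by
  refine le_antisymm ?_ (le_iInf₂ fun U hU => C.le_dim_inter hp hU.1 hU.2)
  exact (iInf₂_le C.domain ⟨C.isOpen_domain, C.den_ne_zero⟩).trans (C.dim_inter_domain_le le_rfl)

end Chart

/-- The dimension of a set is at most the dimension of the members of an open covering. -/
lemma dim_le_of_forall_exists_isOpen {X : Set E} {d : WithBot ℕ∞}
    (h : ∀ p ∈ X, ∃ U, IsOpen U ∧ p ∈ U ∧ dim (X ∩ U) ≤ d) : dim X ≤ d := by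
  -- The coheight of `Z` measures chains above `Z`. All their members meet any open set that meets
  -- `Z`, so the coheight can be computed in `X ∩ U`.
  rw [dim, topologicalKrullDim, Order.krullDim_eq_iSup_coheight]
  refine iSup_le fun Z => ?_
  obtain ⟨⟨p, hp⟩, hpZ⟩ := Z.isIrreducible.nonempty
  obtain ⟨U, hU, hpU, hd⟩ := h p hp
  have hind : IsInducing (Set.inclusion (Set.inter_subset_left : X ∩ U ⊆ X)) :=
    (IsEmbedding.inclusion _).isInducing
  have hemb : IsOpenEmbedding (Set.inclusion (Set.inter_subset_left : X ∩ U ⊆ X)) := by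
    refine ⟨⟨hind, Set.inclusion_injective _⟩, ?_⟩
    convert hU.preimage (continuous_subtype_val (p := (· ∈ X))) using 1
    ext x
    simp [Set.range_inclusion]
  let Z' := (IrreducibleCloseds.orderIsoOfIsOpenEmbedding _ hemb).symm
    ⟨Z, ⟨⟨p, hp, hpU⟩, hpZ⟩⟩
  have hZ' : IrreducibleCloseds.map _ hemb.continuous Z' = Z :=
    congrArg Subtype.val ((IrreducibleCloseds.orderIsoOfIsOpenEmbedding _ hemb).apply_symm_apply
      ⟨Z, ⟨⟨p, hp, hpU⟩, hpZ⟩⟩)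
  rw [← hZ', hemb.coheight_map]
  exact (Order.coheight_le_krullDim Z').trans hd

variable [FiniteDimensional ℂ F] {X : Set E}

lemma dim_eq_of_charts (hne : X.Nonempty) (hX : ∀ p ∈ X, Nonempty (Chart X p F)) :
    dim X = (Module.finrank ℂ F : WithBot ℕ∞) := by
  refine le_antisymm (dim_le_of_forall_exists_isOpen fun p hp => ?_) ?_
  · obtain ⟨C⟩ := hX p hp
    exact ⟨C.domain, C.isOpen_domain, C.den_ne_zero, C.dim_inter_domain_le le_rfl⟩
  · obtain ⟨p, hp⟩ := hne
    obtain ⟨C⟩ := hX p hp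
    simpa using C.le_dim_inter hp isOpen_univ trivial

end

/-! ### Tangent spaces in a chart -/

section

variable {E F : Type*} [AddCommGroup E] [Module ℂ E] [AddCommGroup F] [Module ℂ F]

namespace Chart

variable {X : Set E} {p : E}

/-- A chain rule for curves whose velocity `v` is known only through linear functionals, as `E` has
no norm. By induction on `f`, the curve and its tangent line give the same derivative. -/
lemma hasDerivAt_comp_curve {γ : ℂ → E} {v : E}
    (h : ∀ φ : Module.Dual ℂ E, HasDerivAt (fun t => φ (γ t)) (φ v) 0)
    {f : E → ℂ} (hf : f ∈ polyFun E) :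
    HasDerivAt (fun t => f (γ t)) (deriv (fun t : ℂ => f (γ 0 + t • v)) 0) 0 := by
  have key : ∃ c, HasDerivAt (fun t => f (γ t)) c 0 ∧
      HasDerivAt (fun t : ℂ => f (γ 0 + t • v)) c 0 := by
    induction hf using Algebra.adjoin_induction with
    | mem f hf =>
      obtain ⟨φ, rfl⟩ := hf
      refine ⟨φ v, h φ, ?_⟩
      have h1 : HasDerivAt (fun t : ℂ => φ (γ 0) + t * φ v) (1 * φ v) 0 :=
        ((hasDerivAt_id (0 : ℂ)).mul_const (φ v)).const_add _
      simpa using h1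
    | algebraMap c => exact ⟨0, hasDerivAt_const _ _, hasDerivAt_const _ _⟩
    | add f g _ _ hf hg =>
      obtain ⟨a, ha, ha'⟩ := hf
      obtain ⟨b, hb, hb'⟩ := hg
      exact ⟨a + b, ha.add hb, ha'.add hb'⟩
    | mul f g _ _ hf hg =>
      obtain ⟨a, ha, ha'⟩ := hf
      obtain ⟨b, hb, hb'⟩ := hg
      refine ⟨a * g (γ 0) + f (γ 0) * b, ha.mul hb, ?_⟩
      simpa using! ha'.mul hb'
  obtain ⟨c, h1, h2⟩ := key
  rwa [h2.deriv]

/-- The tangent vector is the velocity at `0` of the curve `inv (proj p + t • w)`, which stays in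
`X` for small `t`, so functions vanishing on `X` have derivative zero along it. -/
lemma exists_tangent [FiniteDimensional ℂ E] (C : Chart X p F) (hp : p ∈ X) (w : F) :
    ∃ v ∈ tangentSpace X p, C.proj v = w := by
  let γ : ℂ → E := fun t => C.inv (C.proj p + t • w)
  have γ0 : γ 0 = p := by simpa [γ] using C.inv_proj p hp C.den_ne_zero
  -- The neighbourhoods are those of the usual topology of `ℂ`.
  have hnear : ∀ᶠ t in 𝓝 (0 : ℂ), C.den (C.proj p + t • w) ≠ 0 := by
    obtain ⟨L, hL⟩ := exists_differential C.den_mem (C.proj p)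
    refine (hL w).continuousAt.eventually_ne ?_
    simpa using C.den_ne_zero
  have hdiff (φ : Module.Dual ℂ E) : DifferentiableAt ℂ (fun t => φ (γ t)) 0 := by
    obtain ⟨L, hL⟩ := exists_differential C.den_mem (C.proj p)
    obtain ⟨M, hM⟩ := exists_differential (C.isPolyMap φ) (C.proj p)
    have h := (hM w).differentiableAt.div (hL w).differentiableAt
      (by simpa using C.den_ne_zero)
    refine h.congr_of_eventuallyEq (hnear.mono fun t ht => ?_)
    simp [γ, ← C.den_smul_inv _ ht, ht]
  let b := Module.finBasis ℂ E
  let v : E := ∑ i, deriv (fun t => b.coord i (γ t)) 0 • b i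
  have hv (φ : Module.Dual ℂ E) : HasDerivAt (fun t => φ (γ t)) (φ v) 0 := by
    have h := HasDerivAt.fun_sum (u := Finset.univ) fun i _ =>
      ((hdiff (b.coord i)).hasDerivAt).mul_const (φ (b i))
    have hφ (x : E) : φ x = ∑ i, b.coord i x * φ (b i) := by
      conv_lhs => rw [← b.sum_repr x]
      simp only [map_sum, map_smul, smul_eq_mul, Module.Basis.coord_apply]
    simp only [← hφ] at h
    simpa [v] using h
  refine ⟨v, fun f hf hfX => ?_, ?_⟩
  · rw [← γ0]
    have h1 := hasDerivAt_comp_curve hv hf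
    rw [← h1.deriv]
    have h2 : (fun t => f (γ t)) =ᶠ[𝓝 0] fun _ => 0 :=
      hnear.mono fun t ht => hfX _ (C.inv_mem _ ht)
    rw [h2.deriv_eq, deriv_const]
  · rw [← sub_eq_zero, ← Module.forall_dual_apply_eq_zero_iff ℂ]
    intro ψ
    rw [map_sub, sub_eq_zero]
    have h1 := hv (ψ ∘ₗ C.proj)
    have h2 : (fun t => (ψ ∘ₗ C.proj) (γ t)) =ᶠ[𝓝 0] fun t => ψ (C.proj p) + t * ψ w :=
      hnear.mono fun t ht => by simp [γ, C.proj_inv _ ht]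
    have h3 : HasDerivAt (fun t : ℂ => ψ (C.proj p) + t * ψ w) (1 * ψ w) 0 :=
      ((hasDerivAt_id (0 : ℂ)).mul_const _).const_add _
    simpa using h1.unique (h3.congr_of_eventuallyEq h2)

lemma eq_zero_of_proj_eq_zero (C : Chart X p F) {w : E} (hw : w ∈ tangentSpace X p)
    (h : C.proj w = 0) : w = 0 := by
  rw [← Module.forall_dual_apply_eq_zero_iff ℂ]
  intro φ
  let H : E → ℂ := fun x => C.den (C.proj x)
  let T : E → ℂ := fun x => φ (C.num (C.proj x))
  have hH : H ∈ polyFun E := (LinearMap.isPolyMap C.proj).comp_mem C.den_mem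
  have hT : T ∈ polyFun E := (LinearMap.isPolyMap C.proj).comp_mem (C.isPolyMap φ)
  -- On `X` one has `H φ = T` wherever `H ≠ 0`; the extra factor `H` makes the function vanish on
  -- the rest of `X`. In a direction killed by `proj`, both `H` and `T` are constant, so the
  -- derivative is `H(p)² φ(w)`.
  have h1 := hw (H * (H * (fun x => φ x) - T))
    (mul_mem hH (sub_mem (mul_mem hH (dual_mem_polyFun φ)) hT)) (fun x hx => by
      by_cases h0 : C.den (C.proj x) = 0
      · simp [H, h0]
      · simp [H, T, ← C.den_smul_inv _ h0, C.inv_proj x hx h0])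
  have h2 : (fun t : ℂ => (H * (H * (fun x => φ x) - T)) (p + t • w)) =
      fun t => H p * (H p * (φ p + t * φ w) - T p) := by
    ext t
    simp [H, T, h]
  rw [h2] at h1
  have h3 : HasDerivAt (fun t : ℂ => H p * (H p * (φ p + t * φ w) - T p))
      (H p * (H p * (1 * φ w))) 0 :=
    (((((hasDerivAt_id (0 : ℂ)).mul_const _).const_add _).const_mul _).sub_const _).const_mul _
  rw [h3.deriv] at h1
  simpa [H, C.den_ne_zero] using h1

lemma finrank_tangentSpace [FiniteDimensional ℂ E] (C : Chart X p F) (hp : p ∈ X) :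
    Module.finrank ℂ (tangentSpace X p) = Module.finrank ℂ F := by
  refine (LinearEquiv.ofBijective (C.proj ∘ₗ (tangentSpace X p).subtype) ⟨?_, ?_⟩).finrank_eq
  · rw [← LinearMap.ker_eq_bot, LinearMap.ker_eq_bot']
    exact fun w hw => Subtype.ext (C.eq_zero_of_proj_eq_zero w.2 hw)
  · intro w
    obtain ⟨v, hv, h⟩ := C.exists_tangent hp w
    exact ⟨⟨v, hv⟩, h⟩

end Chart

variable [FiniteDimensional ℂ F] {X : Set E}

lemma isSmooth_of_charts [FiniteDimensional ℂ E]
    (hX : ∀ p ∈ X, Nonempty (Chart X p F)) : IsSmooth X := by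
  intro p hp
  obtain ⟨C⟩ := hX p hp
  rw [C.localDim_eq hp, C.finrank_tangentSpace hp]

end

end Zar

/-! ### Matrices of fixed rank -/

namespace Zar

open TopologicalSpace Topology

section

variable {E : Type*} [AddCommGroup E] [Module ℂ E] {m n r : ℕ}

lemma isPolyMap_matrix {A : E → Matrix (Fin m) (Fin n) ℂ}
    (hA : ∀ i j, (fun x => A x i j) ∈ polyFun E) : IsPolyMap A :=
  isPolyMap_pi (f := fun i x => A x i) fun i => isPolyMap_pi (f := fun j x => A x i j) fun j => by
    intro φ
    have h : ∀ c : ℂ, φ c = c * φ 1 := fun c => by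
      rw [← smul_eq_mul, ← map_smul, smul_eq_mul, mul_one]
    simp only [h (A _ i j)]
    exact mul_mem (hA i j) (const_mem_polyFun _)

lemma IsPolyMap.entry_mem {A : E → Matrix (Fin m) (Fin n) ℂ} (hA : IsPolyMap A) (i : Fin m)
    (j : Fin n) : (fun x => A x i j) ∈ polyFun E :=
  hA (Matrix.entryLinearMap ℂ ℂ i j)

lemma IsPolyMap.matrix_mul {A : E → Matrix (Fin m) (Fin n) ℂ} {B : E → Matrix (Fin n) (Fin r) ℂ}
    (hA : IsPolyMap A) (hB : IsPolyMap B) : IsPolyMap fun x => A x * B x := by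
  refine isPolyMap_matrix fun i j => ?_
  have h := sum_mem (S := polyFun E) (t := Finset.univ) fun k _ =>
    mul_mem (hA.entry_mem i k) (hB.entry_mem k j)
  convert h using 1
  ext x
  simp [Matrix.mul_apply]

lemma IsPolyMap.det_mem {A : E → Matrix (Fin r) (Fin r) ℂ} (hA : IsPolyMap A) :
    (fun x => (A x).det) ∈ polyFun E := by
  have h := sum_mem (S := polyFun E) (t := Finset.univ) fun (σ : Equiv.Perm (Fin r)) _ =>
    mul_mem (const_mem_polyFun ((Equiv.Perm.sign σ : ℤ) : ℂ)) (prod_mem (t := Finset.univ)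
      fun i _ => hA.entry_mem (σ i) i)
  convert h using 1
  ext x
  simp [Matrix.det_apply']

lemma IsPolyMap.adjugate {A : E → Matrix (Fin r) (Fin r) ℂ} (hA : IsPolyMap A) :
    IsPolyMap fun x => (A x).adjugate := by
  refine isPolyMap_matrix fun i j => ?_
  simp only [Matrix.adjugate_apply]
  refine IsPolyMap.det_mem (isPolyMap_matrix fun k l => ?_)
  by_cases h : k = j
  · subst h
    simpa using const_mem_polyFun _
  · simpa [Matrix.updateRow_ne h] using hA.entry_mem k l

end

section

variable {m n r : ℕ}

/-- The matrices of rank `r`. -/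
def rankSet (m n r : ℕ) : Set (Matrix (Fin m) (Fin n) ℂ) := {x | x.rank = r}

lemma rank_mul_le_width (y : Matrix (Fin m) (Fin r) ℂ) (z : Matrix (Fin r) (Fin n) ℂ) :
    (y * z).rank ≤ r := by
  have := (Matrix.rank_mul_le_left y z).trans y.rank_le_card_width
  simpa using this

lemma rank_of_det_ne_zero {c : Matrix (Fin r) (Fin r) ℂ} (h : c.det ≠ 0) : c.rank = r := by
  have := Matrix.rank_of_isUnit c ((Matrix.isUnit_iff_isUnit_det c).2 h.isUnit)
  simpa using this

lemma le_rank_of_det_ne_zero {x : Matrix (Fin m) (Fin n) ℂ} {a : Matrix (Fin r) (Fin m) ℂ}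
    {b : Matrix (Fin n) (Fin r) ℂ} (h : (a * x * b).det ≠ 0) : r ≤ x.rank := by
  rw [← rank_of_det_ne_zero h]
  exact (Matrix.rank_mul_le_left _ _).trans (Matrix.rank_mul_le_right _ _)

/-- The columns of `b` are preimages of `r` independent vectors in the image of `x`. Then `x * b` is
injective and `a` is a left inverse of it. -/
lemma exists_mul_mul_eq_one {x : Matrix (Fin m) (Fin n) ℂ} (h : r ≤ x.rank) :
    ∃ (a : Matrix (Fin r) (Fin m) ℂ) (b : Matrix (Fin n) (Fin r) ℂ), a * x * b = 1 := by
  let v := Module.finBasis ℂ (LinearMap.range x.mulVecLin)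
  choose u hu using fun i => (v i).2
  let b : Matrix (Fin n) (Fin r) ℂ := Matrix.of fun j i => u (Fin.castLE h i) j
  have hli : LinearIndependent ℂ fun i : Fin r => x.mulVec (u (Fin.castLE h i)) := by
    have h1 := (v.linearIndependent.map' _ (Submodule.ker_subtype _)).comp (Fin.castLE h)
      (Fin.castLE_injective h)
    have h2 : (fun i : Fin r => x.mulVec (u (Fin.castLE h i))) =
        ((LinearMap.range x.mulVecLin).subtype ∘ v) ∘ Fin.castLE h := funext fun i => hu _
    rw [h2]
    exact h1
  have hinj : Function.Injective (x * b).mulVecLin := by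
    rw [Matrix.coe_mulVecLin, Matrix.mulVec_injective_iff]
    have h2 : (x * b).col = fun i : Fin r => x.mulVec (u (Fin.castLE h i)) := by
      ext i j
      simp [Matrix.mul_apply, b, Matrix.mulVec, dotProduct, Matrix.col]
    rw [h2]
    exact hli
  obtain ⟨g, hg⟩ := LinearMap.exists_leftInverse_of_injective _ (LinearMap.ker_eq_bot.2 hinj)
  refine ⟨LinearMap.toMatrix' g, b, ?_⟩
  rw [Matrix.mul_assoc]
  have := congrArg LinearMap.toMatrix' hg
  rwa [LinearMap.toMatrix'_comp, ← Matrix.toLin'_apply', LinearMap.toMatrix'_toLin',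
    LinearMap.toMatrix'_id] at this

/-- Since `x * b` still has rank `r`, it has the column space of `x`, so `x = x * b * c` for some
`c`. Multiplying by `a` determines `c = (a x b)⁻¹ (a x)`. -/
lemma mul_inv_mul_eq_self {x : Matrix (Fin m) (Fin n) ℂ} {a : Matrix (Fin r) (Fin m) ℂ}
    {b : Matrix (Fin n) (Fin r) ℂ} (hx : x.rank = r) (h : (a * x * b).det ≠ 0) :
    x * b * (a * x * b)⁻¹ * (a * x) = x := by
  have hr : (x * b).rank = x.rank := by
    refine le_antisymm (Matrix.rank_mul_le_left _ _) ?_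
    have h1 := rank_of_det_ne_zero h
    rw [Matrix.mul_assoc] at h1
    exact hx.trans_le (h1.symm.trans_le (Matrix.rank_mul_le_right _ _))
  have hrange : LinearMap.range (x * b).mulVecLin = LinearMap.range x.mulVecLin := by
    refine Submodule.eq_of_le_of_finrank_eq ?_ hr
    rw [Matrix.mulVecLin_mul]
    exact LinearMap.range_comp_le_range _ _
  have hc : ∀ j, ∃ c, (x * b).mulVec c = x.col j := by
    intro j
    have : x.col j ∈ LinearMap.range x.mulVecLin := ⟨Pi.single j 1, by simp⟩
    rw [← hrange] at this
    exact this
  choose c hc using hc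
  have hxc : x = x * b * Matrix.of fun i j => c j i := by
    ext i j
    have := congrFun (hc j) i
    rw [Matrix.mul_apply]
    exact this.symm
  have hax : a * x = a * x * b * Matrix.of fun i j => c j i := by
    conv_lhs => rw [hxc]
    simp only [Matrix.mul_assoc]
  have h1 : (a * x * b)⁻¹ * (a * x) = Matrix.of fun i j => c j i := by
    refine (congrArg ((a * x * b)⁻¹ * ·) hax).trans ?_
    rw [← Matrix.mul_assoc, Matrix.nonsing_inv_mul _ h.isUnit, Matrix.one_mul]
  rw [Matrix.mul_assoc, h1]
  exact hxc.symm

/-- Write both endpoints as products through `ℂ^r` and interpolate the two factors linearly. The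
product always has rank at most `r`, and at least `r` where `det (a * c t * b) ≠ 0`; this
determinant is `1` at `t = 0`. -/
lemma curveConnected_rankSet : CurveConnected (rankSet m n r) := by
  intro p hp q hq
  obtain ⟨a, b, hab⟩ := exists_mul_mul_eq_one hp.ge
  obtain ⟨a', b', hab'⟩ := exists_mul_mul_eq_one hq.ge
  have h1 := mul_inv_mul_eq_self hp (a := a) (b := b) (by simp [hab])
  have h2 := mul_inv_mul_eq_self hq (a := a') (b := b') (by simp [hab'])
  simp only [hab, hab', inv_one, Matrix.mul_one] at h1 h2
  have hc : IsPolyMap fun t : ℂ =>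
      (p * b + t • (q * b' - p * b)) * (a * p + t • (a' * q - a * p)) :=
    (isPolyMap_line _ _).matrix_mul (isPolyMap_line _ _)
  refine ⟨_, hc, by simpa using h1, by simpa using h2, _,
    (((isPolyMap_const a).matrix_mul hc).matrix_mul (isPolyMap_const b)).det_mem, ?_, ?_⟩
  · simp [h1, hab]
  · exact fun t ht => le_antisymm (rank_mul_le_width _ _) (le_rank_of_det_ne_zero ht)

lemma rankSet_nonempty (hm : r ≤ m) (hn : r ≤ n) : (rankSet m n r).Nonempty := by
  let a : Matrix (Fin r) (Fin m) ℂ := Matrix.of fun i j => if (i : ℕ) = j then 1 else 0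
  let b : Matrix (Fin n) (Fin r) ℂ := Matrix.of fun i j => if (i : ℕ) = j then 1 else 0
  have ha : a * a.transpose = 1 := by
    ext i j
    rw [Matrix.mul_apply, Finset.sum_eq_single (Fin.castLE hm i)]
    · simp [a, Matrix.one_apply, Fin.ext_iff, eq_comm]
    · intro k _ hk
      simp [a, Fin.ext_iff] at hk ⊢
      omega
    · simp
  have hb : b.transpose * b = 1 := by
    ext i j
    rw [Matrix.mul_apply, Finset.sum_eq_single (Fin.castLE hn i)]
    · simp [b, Matrix.one_apply, Fin.ext_iff]
    · intro k _ hk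
      simp [b, Fin.ext_iff] at hk ⊢
      omega
    · simp
  refine ⟨a.transpose * b.transpose, le_antisymm (rank_mul_le_width _ _) ?_⟩
  refine le_rank_of_det_ne_zero (a := a) (b := b) ?_
  rw [← Matrix.mul_assoc, ha, Matrix.one_mul, hb]
  simp

/-- The pairs `(y, z)` of matrices with `a * y = z * b`. -/
def matchingPairs (a : Matrix (Fin r) (Fin m) ℂ) (b : Matrix (Fin n) (Fin r) ℂ) :
    Submodule ℂ (Matrix (Fin m) (Fin r) ℂ × Matrix (Fin r) (Fin n) ℂ) where
  carrier := {w | a * w.1 = w.2 * b}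
  zero_mem' := by simp
  add_mem' := by
    intro v w hv hw
    simp only [Set.mem_ofPred_eq] at hv hw ⊢
    simp [Matrix.mul_add, Matrix.add_mul, hv, hw]
  smul_mem' := by
    intro c w hw
    simp only [Set.mem_ofPred_eq] at hw ⊢
    simp [hw]

/-- The space is the kernel of `(y, z) ↦ a y - z b`, which is onto the `r × r` matrices because `(p
b M, 0)` maps to `M`. -/
lemma finrank_matchingPairs {a : Matrix (Fin r) (Fin m) ℂ} {b : Matrix (Fin n) (Fin r) ℂ}
    {p : Matrix (Fin m) (Fin n) ℂ} (h : a * p * b = 1) :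
    Module.finrank ℂ (matchingPairs a b) + r * r = m * r + r * n := by
  let T : Matrix (Fin m) (Fin r) ℂ × Matrix (Fin r) (Fin n) ℂ →ₗ[ℂ] Matrix (Fin r) (Fin r) ℂ :=
    { toFun := fun w => a * w.1 - w.2 * b
      map_add' := fun v w => by
        simp only [Prod.fst_add, Prod.snd_add, Matrix.mul_add, Matrix.add_mul]
        abel
      map_smul' := fun c w => by simp [smul_sub] }
  have hT : LinearMap.range T = ⊤ := by
    rw [LinearMap.range_eq_top]
    intro M
    refine ⟨(p * b * M, 0), ?_⟩
    change a * (p * b * M) - (0 : Matrix (Fin r) (Fin n) ℂ) * b = M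
    rw [← Matrix.mul_assoc, ← Matrix.mul_assoc, h, Matrix.zero_mul, Matrix.one_mul, sub_zero]
  have hker : matchingPairs a b = LinearMap.ker T := by
    ext w
    exact sub_eq_zero.symm
  have := LinearMap.finrank_range_add_finrank_ker T
  rw [hT, finrank_top, ← hker] at this
  simp only [Module.finrank_prod, Module.finrank_matrix, Fintype.card_fin, Module.finrank_self,
    mul_one] at this
  omega

noncomputable def chartRankSet (a : Matrix (Fin r) (Fin m) ℂ) (b : Matrix (Fin n) (Fin r) ℂ)
    {p : Matrix (Fin m) (Fin n) ℂ} (h : a * p * b = 1) :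
    Chart (rankSet m n r) p (matchingPairs a b) where
  proj :=
    { toFun := fun x => ⟨(x * b, a * x), (Matrix.mul_assoc _ _ _).symm⟩
      map_add' := fun x y => by ext <;> simp [Matrix.mul_add, Matrix.add_mul]
      map_smul' := fun c x => by ext <;> simp }
  den w := (a * w.1.1).det
  -- Cramer's rule: `det • inverse = adjugate` is polynomial.
  num w := w.1.1 * (a * w.1.1).adjugate * w.1.2
  inv w := w.1.1 * (a * w.1.1)⁻¹ * w.1.2
  den_mem := ((isPolyMap_const a).matrix_mul
    (LinearMap.isPolyMap (LinearMap.fst ℂ _ _ ∘ₗ (matchingPairs a b).subtype))).det_mem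
  isPolyMap := by
    have h1 := LinearMap.isPolyMap (LinearMap.fst ℂ _ _ ∘ₗ (matchingPairs a b).subtype)
    have h2 := LinearMap.isPolyMap (LinearMap.snd ℂ _ _ ∘ₗ (matchingPairs a b).subtype)
    exact (h1.matrix_mul ((isPolyMap_const a).matrix_mul h1).adjugate).matrix_mul h2
  den_smul_inv w hw := by
    rw [Matrix.inv_def, Ring.inverse_eq_inv']
    simp [smul_smul, mul_inv_cancel₀ hw]
  den_ne_zero := by
    change (a * (p * b)).det ≠ 0
    rw [← Matrix.mul_assoc, h]
    simp
  inv_mem w hw := by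
    refine le_antisymm (rank_mul_le_width (w.1.1 * (a * w.1.1)⁻¹) w.1.2) ?_
    refine le_rank_of_det_ne_zero (a := a) (b := b) ?_
    have hw2 : a * w.1.1 = w.1.2 * b := w.2
    simp only [Matrix.mul_assoc]
    rw [← hw2, Matrix.nonsing_inv_mul _ (Ne.isUnit hw), Matrix.mul_one]
    exact hw
  proj_inv w hw := by
    have hw2 : a * w.1.1 = w.1.2 * b := w.2
    refine Subtype.ext (Prod.ext ?_ ?_)
    · change w.1.1 * (a * w.1.1)⁻¹ * w.1.2 * b = w.1.1
      rw [Matrix.mul_assoc, Matrix.mul_assoc, ← hw2, Matrix.nonsing_inv_mul _ (Ne.isUnit hw),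
        Matrix.mul_one]
    · change a * (w.1.1 * (a * w.1.1)⁻¹ * w.1.2) = w.1.2
      rw [← Matrix.mul_assoc, ← Matrix.mul_assoc, Matrix.mul_nonsing_inv _ (Ne.isUnit hw),
        Matrix.one_mul]
  inv_proj x hx hd := by
    change (a * (x * b)).det ≠ 0 at hd
    rw [← Matrix.mul_assoc] at hd
    change x * b * (a * (x * b))⁻¹ * (a * x) = x
    rw [← Matrix.mul_assoc a x b]
    exact mul_inv_mul_eq_self hx hd

/-- Replaces the model space, which depends on `a` and `b`, by one common to all points. The
subtraction is not truncated, by `finrank_matchingPairs`. -/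
lemma nonempty_chart_rankSet {p : Matrix (Fin m) (Fin n) ℂ} (hp : p ∈ rankSet m n r) :
    Nonempty (Chart (rankSet m n r) p (Fin (m * r + r * n - r * r) → ℂ)) := by
  obtain ⟨a, b, h⟩ := exists_mul_mul_eq_one (x := p) (r := r) hp.ge
  refine ⟨(chartRankSet a b h).congr (LinearEquiv.ofFinrankEq _ _ ?_)⟩
  have := finrank_matchingPairs h
  rw [Module.finrank_fin_fun]
  omega

end

section

attribute [local instance] zariski

variable {E F : Type*} [AddCommGroup E] [Module ℂ E] [AddCommGroup F] [Module ℂ F]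

lemma IsLocClosed.comap {X : Set F} (hX : IsLocClosed X) (L : E →ₗ[ℂ] F) :
    IsLocClosed (L ⁻¹' X) :=
  IsLocallyClosed.preimage hX (LinearMap.isPolyMap L).continuous

lemma IsLocClosed.iInter {ι : Type*} [Finite ι] {X : ι → Set E} (hX : ∀ i, IsLocClosed (X i)) :
    IsLocClosed (⋂ i, X i) := by
  choose U Z hU hZ h using hX
  refine ⟨⋂ i, U i, ⋂ i, Z i, isOpen_iInter_of_finite hU, isClosed_iInter hZ, ?_⟩
  rw [← Set.iInter_inter_distrib]
  exact Set.iInter_congr h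

lemma IsLocClosed.pi {ι : Type*} [Finite ι] {M : ι → Type*} [∀ i, AddCommGroup (M i)]
    [∀ i, Module ℂ (M i)] {X : ∀ i, Set (M i)} (hX : ∀ i, IsLocClosed (X i)) :
    IsLocClosed (Set.univ.pi X) := by
  rw [Set.univ_pi_eq_iInter]
  exact IsLocClosed.iInter fun i => (hX i).comap (LinearMap.proj i)

end

section

lemma isOpen_le_rank (m n r : ℕ) :
    IsOpen[zariski (Matrix (Fin m) (Fin n) ℂ)] {x | r ≤ x.rank} := by
  let _ := zariski (Matrix (Fin m) (Fin n) ℂ)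
  have : {x : Matrix (Fin m) (Fin n) ℂ | r ≤ x.rank} = ⋃ (a : Matrix (Fin r) (Fin m) ℂ)
      (b : Matrix (Fin n) (Fin r) ℂ), {x | (a * x * b).det ≠ 0} := by
    ext x
    simp only [Set.mem_iUnion]
    constructor
    · intro h
      obtain ⟨a, b, hab⟩ := exists_mul_mul_eq_one (x := x) h
      exact ⟨a, b, by simp [hab]⟩
    · rintro ⟨a, b, h⟩
      exact le_rank_of_det_ne_zero h
  rw [this]
  exact isOpen_iUnion fun a => isOpen_iUnion fun b => isOpen_ne
    (((isPolyMap_const a).matrix_mul isPolyMap_id).matrix_mul (isPolyMap_const b)).det_mem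

lemma isLocClosed_rankSet (m n r : ℕ) : IsLocClosed (rankSet m n r) := by
  refine ⟨{x | r ≤ x.rank}, {x | r + 1 ≤ x.rank}ᶜ, isOpen_le_rank m n r,
    @IsOpen.isClosed_compl _ (zariski _) _ (isOpen_le_rank m n (r + 1)), ?_⟩
  ext x
  simp only [rankSet, Set.mem_ofPred_eq, Set.mem_inter_iff, Set.mem_compl_iff]
  omega

/-- A set of tuples of matrices of prescribed ranks is locally closed, irreducible and smooth,
also after a linear change of coordinates. -/
theorem geometry_of_rankSets {ι : Type*} [Fintype ι] {E : Type*} [AddCommGroup E] [Module ℂ E]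
    {m n r : ι → ℕ} (e : E ≃ₗ[ℂ] (∀ i, Matrix (Fin (m i)) (Fin (n i)) ℂ))
    (hm : ∀ i, r i ≤ m i) (hn : ∀ i, r i ≤ n i) {X : Set E}
    (hX : X = e ⁻¹' Set.univ.pi fun i => rankSet (m i) (n i) (r i)) :
    IsLocClosed X ∧ IsIrred X ∧ IsSmooth X ∧
      dim X = ((∑ i, (m i * r i + r i * n i - r i * r i) : ℕ) : WithBot ℕ∞) := by
  classical
  have := Module.Finite.equiv e.symm
  subst hX
  have hne : (e ⁻¹' Set.univ.pi fun i => rankSet (m i) (n i) (r i)).Nonempty := by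
    choose x hx using fun i => rankSet_nonempty (hm i) (hn i)
    exact ⟨e.symm x, fun i _ => by simpa using hx i⟩
  have hchart : ∀ p ∈ e ⁻¹' Set.univ.pi fun i => rankSet (m i) (n i) (r i),
      Nonempty (Chart (e ⁻¹' Set.univ.pi fun i => rankSet (m i) (n i) (r i)) p
        (∀ i, Fin (m i * r i + r i * n i - r i * r i) → ℂ)) := by
    intro p hp
    exact ⟨(Chart.pi fun i => (nonempty_chart_rankSet (hp i trivial)).some).comap e⟩
  refine ⟨(IsLocClosed.pi fun i => isLocClosed_rankSet _ _ _).comap e.toLinearMap,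
    ⟨hne, ((CurveConnected.pi fun i => curveConnected_rankSet).comap e).isPreirreducible⟩,
    isSmooth_of_charts hchart, ?_⟩
  rw [dim_eq_of_charts hne hchart, Module.finrank_pi_fintype]
  simp

end

end Zar

/-! ### Additive functions on the representation ring and Schur's lemma -/

section

variable {𝔤 : Type u} [LieRing 𝔤] [LieAlgebra ℂ 𝔤]

namespace RepRing

/-- The homomorphism from `R(𝔤)` to `ℤ` given by an additive function of representations. -/
noncomputable def lift (φ : LieRep.{u, v} 𝔤 → ℤ)
    (h : ∀ U V W, LieRep.IsSum U V W → φ U = φ V + φ W) : RepRing.{u, v} 𝔤 →+ ℤ :=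
  QuotientAddGroup.lift _ (FreeAbelianGroup.lift φ) <| by
    rw [AddSubgroup.closure_le]
    rintro _ ⟨U, V, W, hU, rfl⟩
    simp [h U V W hU]

@[simp]
lemma lift_cl (φ : LieRep.{u, v} 𝔤 → ℤ)
    (h : ∀ U V W, LieRep.IsSum U V W → φ U = φ V + φ W) (V : Type v) [AddCommGroup V] [Module ℂ V]
    [LieRingModule 𝔤 V] [LieModule ℂ 𝔤 V] [FiniteDimensional ℂ V] :
    lift φ h (cl 𝔤 V) = φ (LieRep.mk V) :=
  FreeAbelianGroup.lift_apply_of _ _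

end RepRing

lemma cl_eq_add {U V W : LieRep.{u, v} 𝔤} (h : LieRep.IsSum U V W) :
    cl 𝔤 U.carrier = cl 𝔤 V.carrier + cl 𝔤 W.carrier := by
  refine (QuotientAddGroup.eq_iff_sub_mem).2 (AddSubgroup.subset_closure ?_)
  exact ⟨U, V, W, h, rfl⟩

section

variable {V W Y : Type v}
  [AddCommGroup V] [Module ℂ V] [LieRingModule 𝔤 V] [LieModule ℂ 𝔤 V]
  [AddCommGroup W] [Module ℂ W] [LieRingModule 𝔤 W] [LieModule ℂ 𝔤 W]
  [AddCommGroup Y] [Module ℂ Y] [LieRingModule 𝔤 Y] [LieModule ℂ 𝔤 Y]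

namespace LieModuleHom

/-- Forgetting the action, as a linear map. -/
def toLinearMapₗ : (V →ₗ⁅ℂ, 𝔤⁆ W) →ₗ[ℂ] V →ₗ[ℂ] W where
  toFun f := f
  map_add' _ _ := rfl
  map_smul' _ _ := rfl

lemma toLinearMapₗ_injective :
    Function.Injective (toLinearMapₗ : (V →ₗ⁅ℂ, 𝔤⁆ W) →ₗ[ℂ] V →ₗ[ℂ] W) :=
  fun f g h => by
    ext x
    exact LinearMap.congr_fun h x

instance [FiniteDimensional ℂ V] [FiniteDimensional ℂ W] :
    FiniteDimensional ℂ (V →ₗ⁅ℂ, 𝔤⁆ W) :=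
  Module.Finite.of_injective _ toLinearMapₗ_injective

/-- Composition of morphisms as a bilinear map. -/
def postcomp (Y : Type v) [AddCommGroup Y] [Module ℂ Y] [LieRingModule 𝔤 Y] [LieModule ℂ 𝔤 Y] :
    (V →ₗ⁅ℂ, 𝔤⁆ W) →ₗ[ℂ] (Y →ₗ⁅ℂ, 𝔤⁆ V) →ₗ[ℂ] (Y →ₗ⁅ℂ, 𝔤⁆ W) where
  toFun f :=
    { toFun := fun g => f.comp g
      map_add' := fun g h => by ext x; simp
      map_smul' := fun c g => by ext x; simp }
  map_add' f g := by ext h x; rfl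
  map_smul' c f := by ext h x; rfl

end LieModuleHom

end

lemma LieRep.IsSum.exists_morphisms {U V W : LieRep.{u, v} 𝔤} (h : LieRep.IsSum U V W) :
    ∃ (p₁ : U.carrier →ₗ⁅ℂ, 𝔤⁆ V.carrier) (p₂ : U.carrier →ₗ⁅ℂ, 𝔤⁆ W.carrier)
      (i₁ : V.carrier →ₗ⁅ℂ, 𝔤⁆ U.carrier) (i₂ : W.carrier →ₗ⁅ℂ, 𝔤⁆ U.carrier),
      (∀ x, p₁ (i₁ x) = x) ∧ (∀ x, p₂ (i₂ x) = x) ∧ (∀ x, p₁ (i₂ x) = 0) ∧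
      (∀ x, p₂ (i₁ x) = 0) ∧ ∀ x, i₁ (p₁ x) + i₂ (p₂ x) = x := by
  obtain ⟨e, he⟩ := h
  refine ⟨{ LinearMap.fst ℂ _ _ ∘ₗ e.toLinearMap with map_lie' := fun {x m} => ?_ },
    { LinearMap.snd ℂ _ _ ∘ₗ e.toLinearMap with map_lie' := fun {x m} => ?_ },
    { e.symm.toLinearMap ∘ₗ LinearMap.inl ℂ _ _ with map_lie' := fun {x m} => ?_ },
    { e.symm.toLinearMap ∘ₗ LinearMap.inr ℂ _ _ with map_lie' := fun {x m} => ?_ },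
    fun x => ?_, fun x => ?_, fun x => ?_, fun x => ?_, fun x => ?_⟩
  · exact congrArg Prod.fst (he x m)
  · exact congrArg Prod.snd (he x m)
  · refine e.symm_apply_eq.2 ?_
    change _ = e ⁅x, e.symm (m, 0)⁆
    rw [he]
    simp
  · refine e.symm_apply_eq.2 ?_
    change _ = e ⁅x, e.symm (0, m)⁆
    rw [he]
    simp
  · change (e (e.symm (x, 0))).1 = x
    simp
  · change (e (e.symm (0, x))).2 = x
    simp
  · change (e (e.symm (0, x))).1 = 0
    simp
  · change (e (e.symm (x, 0))).2 = 0
    simp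
  · change e.symm ((e x).1, 0) + e.symm (0, (e x).2) = x
    rw [← map_add]
    simp

namespace RepRing

variable (𝔤) in
/-- The dimension, as a homomorphism `R(𝔤) → ℤ`. -/
noncomputable def rank : RepRing.{u, v} 𝔤 →+ ℤ :=
  lift (fun U => Module.finrank ℂ U.carrier) fun U V W ⟨e, _⟩ => by
    simp [e.finrank_eq]

variable (Y : Type v) [AddCommGroup Y] [Module ℂ Y] [LieRingModule 𝔤 Y] [LieModule ℂ 𝔤 Y]
  [FiniteDimensional ℂ Y]

/-- The homomorphism `R(𝔤) → ℤ` that maps the class of `U` to `dim hom_𝔤(Y, U)`. -/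
noncomputable def homFrom : RepRing.{u, v} 𝔤 →+ ℤ :=
  lift (fun U => Module.finrank ℂ (Y →ₗ⁅ℂ, 𝔤⁆ U.carrier)) fun U V W h => by
    obtain ⟨p₁, p₂, i₁, i₂, h11, h22, h12, h21, hs⟩ := h.exists_morphisms
    let e : (Y →ₗ⁅ℂ, 𝔤⁆ U.carrier) ≃ₗ[ℂ] (Y →ₗ⁅ℂ, 𝔤⁆ V.carrier) × (Y →ₗ⁅ℂ, 𝔤⁆ W.carrier) :=
      { toFun := fun f => (p₁.comp f, p₂.comp f)
        invFun := fun f => i₁.comp f.1 + i₂.comp f.2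
        map_add' := fun f g => by ext <;> simp
        map_smul' := fun c f => by ext <;> simp
        left_inv := fun f => by ext x; simp [hs]
        right_inv := fun f => by ext <;> simp [h11, h22, h12, h21] }
    simp [e.finrank_eq]

/-- The homomorphism `R(𝔤) → ℤ` that maps the class of `U` to `dim hom_𝔤(U, Y)`. -/
noncomputable def homTo : RepRing.{u, v} 𝔤 →+ ℤ :=
  lift (fun U => Module.finrank ℂ (U.carrier →ₗ⁅ℂ, 𝔤⁆ Y)) fun U V W h => by
    obtain ⟨p₁, p₂, i₁, i₂, h11, h22, h12, h21, hs⟩ := h.exists_morphisms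
    let e : (U.carrier →ₗ⁅ℂ, 𝔤⁆ Y) ≃ₗ[ℂ] (V.carrier →ₗ⁅ℂ, 𝔤⁆ Y) × (W.carrier →ₗ⁅ℂ, 𝔤⁆ Y) :=
      { toFun := fun f => (f.comp i₁, f.comp i₂)
        invFun := fun f => f.1.comp p₁ + f.2.comp p₂
        map_add' := fun f g => by ext <;> simp
        map_smul' := fun c f => by ext <;> simp
        left_inv := fun f => by
          ext x
          simp [← map_add, hs]
        right_inv := fun f => by ext <;> simp [h11, h22, h12, h21] }
    simp [e.finrank_eq]

variable (U : Type v) [AddCommGroup U] [Module ℂ U] [LieRingModule 𝔤 U] [LieModule ℂ 𝔤 U]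
  [FiniteDimensional ℂ U]

lemma rank_cl : rank 𝔤 (cl 𝔤 U) = Module.finrank ℂ U := lift_cl _ _ _

lemma homFrom_cl : homFrom Y (cl 𝔤 U) = Module.finrank ℂ (Y →ₗ⁅ℂ, 𝔤⁆ U) := lift_cl _ _ _

lemma homTo_cl : homTo Y (cl 𝔤 U) = Module.finrank ℂ (U →ₗ⁅ℂ, 𝔤⁆ Y) := lift_cl _ _ _

lemma Nonneg.homFrom_nonneg {S : RepRing.{u, v} 𝔤} (hS : S.Nonneg) : 0 ≤ homFrom Y S := by
  induction hS using AddSubmonoid.closure_induction with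
  | mem x hx =>
    obtain ⟨V, _, rfl⟩ := hx
    rw [homFrom_cl]
    positivity
  | zero => simp
  | add x y _ _ hx hy =>
    rw [map_add]
    exact add_nonneg hx hy

lemma homFrom_mono {S T : RepRing.{u, v} 𝔤} (h : S ≤ T) : homFrom Y S ≤ homFrom Y T := by
  have := Nonneg.homFrom_nonneg Y (S := T - S) h
  rw [map_sub] at this
  omega

end RepRing

section

variable {U V W : Type v}
  [AddCommGroup U] [Module ℂ U] [LieRingModule 𝔤 U] [LieModule ℂ 𝔤 U] [FiniteDimensional ℂ U]
  [AddCommGroup V] [Module ℂ V] [LieRingModule 𝔤 V] [LieModule ℂ 𝔤 V] [FiniteDimensional ℂ V]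
  [AddCommGroup W] [Module ℂ W] [LieRingModule 𝔤 W] [LieModule ℂ 𝔤 W] [FiniteDimensional ℂ W]

lemma cl_coe_congr {A B : LieSubmodule ℂ 𝔤 U} (h : A = B) : cl 𝔤 A = cl 𝔤 B := by
  subst h
  rfl

lemma cl_sup {A B : LieSubmodule ℂ 𝔤 U} (h : Disjoint A B) :
    cl 𝔤 (A ⊔ B : LieSubmodule ℂ 𝔤 U) = cl 𝔤 A + cl 𝔤 B := by
  refine cl_eq_add (U := LieRep.mk (A ⊔ B : LieSubmodule ℂ 𝔤 U)) (V := LieRep.mk A)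
    (W := LieRep.mk B) ?_
  let T : (A × B) →ₗ[ℂ] (A ⊔ B : LieSubmodule ℂ 𝔤 U) :=
    { toFun := fun w => ⟨w.1 + w.2, (LieSubmodule.mem_sup _ _ _).2 ⟨_, w.1.2, _, w.2.2, rfl⟩⟩
      map_add' := fun v w => Subtype.ext (by simp; abel)
      map_smul' := fun c w => Subtype.ext (by simp) }
  have hT : Function.Bijective T := by
    constructor
    · rw [← LinearMap.ker_eq_bot, LinearMap.ker_eq_bot']
      rintro ⟨a, b⟩ hab
      have h1 : (a : U) + b = 0 := congrArg Subtype.val hab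
      have h2 : (a : U) ∈ A ⊓ B := ⟨a.2, by
        rw [eq_neg_of_add_eq_zero_left h1]
        exact B.neg_mem b.2⟩
      rw [h.eq_bot, LieSubmodule.mem_bot] at h2
      rw [h2, zero_add] at h1
      exact Prod.ext (Subtype.ext h2) (Subtype.ext h1)
    · rintro ⟨x, hx⟩
      obtain ⟨a, ha, b, hb, rfl⟩ := (LieSubmodule.mem_sup _ _ _).1 hx
      exact ⟨(⟨a, ha⟩, ⟨b, hb⟩), rfl⟩
  let e := LinearEquiv.ofBijective T hT
  refine ⟨e.symm, fun x a => ?_⟩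
  obtain ⟨w, rfl⟩ := e.surjective a
  rw [LinearEquiv.symm_apply_eq, e.symm_apply_apply]
  refine Subtype.ext ?_
  change ⁅x, (w.1 + w.2 : U)⁆ = ⁅x, (w.1 : U)⁆ + ⁅x, (w.2 : U)⁆
  exact lie_add _ _ _

/-- From `⊥ = ⊥ ⊕ ⊥` the class equals its own double. -/
lemma cl_bot : cl 𝔤 (⊥ : LieSubmodule ℂ 𝔤 U) = 0 := by
  have h := cl_sup (disjoint_bot_left : Disjoint (⊥ : LieSubmodule ℂ 𝔤 U) ⊥)
  rw [cl_coe_congr (sup_idem (⊥ : LieSubmodule ℂ 𝔤 U))] at h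
  exact left_eq_add.1 h

lemma cl_congr (e : V →ₗ⁅ℂ, 𝔤⁆ W) (he : Function.Bijective e) : cl 𝔤 V = cl 𝔤 W := by
  have h : LieRep.IsSum (𝔤 := 𝔤) (LieRep.mk V) (LieRep.mk W) (LieRep.mk (⊥ : LieSubmodule ℂ 𝔤 W)) := by
    refine ⟨(LinearEquiv.ofBijective (e : V →ₗ[ℂ] W) he).trans
      (LinearEquiv.prodUnique (R := ℂ)).symm, fun x a => Prod.ext (e.map_lie x a) ?_⟩
    exact Subsingleton.elim (α := (⊥ : LieSubmodule ℂ 𝔤 W)) _ _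
  have h1 := cl_eq_add h
  simpa [cl_bot] using h1

lemma cl_top : cl 𝔤 (⊤ : LieSubmodule ℂ 𝔤 U) = cl 𝔤 U :=
  cl_congr (LieSubmodule.incl ⊤) ⟨LieSubmodule.injective_incl _, fun x => ⟨⟨x, trivial⟩, rfl⟩⟩

lemma cl_range_of_injective (f : V →ₗ⁅ℂ, 𝔤⁆ W) (hf : Function.Injective f) :
    cl 𝔤 f.range = cl 𝔤 V := by
  refine (cl_congr (f.codRestrict f.range fun x => ⟨x, rfl⟩) ⟨fun x y h => ?_, ?_⟩).symm
  · exact hf (congrArg Subtype.val h)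
  · rintro ⟨_, x, rfl⟩
    exact ⟨x, rfl⟩

end

section Schur

variable {V W : Type v}
  [AddCommGroup V] [Module ℂ V] [LieRingModule 𝔤 V] [LieModule ℂ 𝔤 V]
  [AddCommGroup W] [Module ℂ W] [LieRingModule 𝔤 W] [LieModule ℂ 𝔤 W]

lemma LieModuleHom.injective_of_ne_zero [LieModule.IsIrreducible ℂ 𝔤 V] {f : V →ₗ⁅ℂ, 𝔤⁆ W}
    (hf : f ≠ 0) : Function.Injective f := by
  rw [← LieModuleHom.ker_eq_bot]
  refine (IsSimpleOrder.eq_bot_or_eq_top f.ker).resolve_right fun h => hf ?_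
  ext x
  have : x ∈ f.ker := h ▸ LieSubmodule.mem_top x
  simpa using this

lemma LieModuleHom.bijective_of_ne_zero [LieModule.IsIrreducible ℂ 𝔤 V]
    [LieModule.IsIrreducible ℂ 𝔤 W] {f : V →ₗ⁅ℂ, 𝔤⁆ W} (hf : f ≠ 0) : Function.Bijective f := by
  refine ⟨injective_of_ne_zero hf, ?_⟩
  rw [← LieModuleHom.range_eq_top]
  refine (IsSimpleOrder.eq_bot_or_eq_top f.range).resolve_left fun h => hf ?_
  ext x
  have : f x ∈ f.range := ⟨x, rfl⟩
  rw [h, LieSubmodule.mem_bot] at this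
  simpa using this

/-- **Schur's lemma** for endomorphisms. -/
lemma finrank_end_of_isIrreducible [FiniteDimensional ℂ V] (h : LieModule.IsIrreducible ℂ 𝔤 V) :
    Module.finrank ℂ (V →ₗ⁅ℂ, 𝔤⁆ V) = 1 := by
  have hnt := LieModule.nontrivial_of_isIrreducible ℂ 𝔤 V
  refine (finrank_eq_one_iff_of_nonzero' (LieModuleHom.id : V →ₗ⁅ℂ, 𝔤⁆ V) ?_).2 fun f => ?_
  · intro h0
    obtain ⟨x, hx⟩ := exists_ne (0 : V)
    exact hx (LieModuleHom.congr_fun h0 x)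
  · obtain ⟨c, hc⟩ := Module.End.exists_eigenvalue (f : Module.End ℂ V)
    obtain ⟨x, hx⟩ := hc.exists_hasEigenvector
    refine ⟨c, ?_⟩
    by_contra hne
    have := LieModuleHom.injective_of_ne_zero (sub_ne_zero.2 hne)
    refine hx.2 (this ?_)
    have h1 : f x = c • x := hx.apply_eq_smul
    simp [h1]

/-- **Schur's lemma** for non-isomorphic irreducible representations. -/
lemma finrank_hom_of_isEmpty (hV : LieModule.IsIrreducible ℂ 𝔤 V)
    (hW : LieModule.IsIrreducible ℂ 𝔤 W) (h : IsEmpty (V ≃ₗ⁅ℂ, 𝔤⁆ W)) :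
    Module.finrank ℂ (V →ₗ⁅ℂ, 𝔤⁆ W) = 0 := by
  have : Subsingleton (V →ₗ⁅ℂ, 𝔤⁆ W) := by
    refine subsingleton_of_forall_eq 0 fun f => by_contra fun hf => ?_
    have hb := LieModuleHom.bijective_of_ne_zero hf
    let e := LinearEquiv.ofBijective (f : V →ₗ[ℂ] W) hb
    exact h.false { f with invFun := e.symm, left_inv := e.left_inv, right_inv := e.right_inv }
  exact Module.finrank_zero_of_subsingleton

end Schur

end

/-! ### Multiplicity spaces -/

section

variable {𝔤 : Type u} [LieRing 𝔤] [LieAlgebra ℂ 𝔤] {k : ℕ} {X : Fin k → Type v}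
  [∀ i, AddCommGroup (X i)] [∀ i, Module ℂ (X i)] [∀ i, LieRingModule 𝔤 (X i)]
  [∀ i, LieModule ℂ 𝔤 (X i)] [∀ i, FiniteDimensional ℂ (X i)]
  {U V W : Type v}
  [AddCommGroup U] [Module ℂ U] [LieRingModule 𝔤 U] [LieModule ℂ 𝔤 U] [FiniteDimensional ℂ U]
  [AddCommGroup V] [Module ℂ V] [LieRingModule 𝔤 V] [LieModule ℂ 𝔤 V] [FiniteDimensional ℂ V]
  [AddCommGroup W] [Module ℂ W] [LieRingModule 𝔤 W] [LieModule ℂ 𝔤 W] [FiniteDimensional ℂ W]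

open RepRing

lemma homFrom_cl_eq_ite (hirr : ∀ i, LieModule.IsIrreducible ℂ 𝔤 (X i))
    (hne : ∀ i j, i ≠ j → IsEmpty (X i ≃ₗ⁅ℂ, 𝔤⁆ X j)) (i j : Fin k) :
    homFrom (X i) (cl 𝔤 (X j)) = if j = i then 1 else 0 := by
  rw [homFrom_cl]
  split_ifs with h
  · subst h
    exact_mod_cast finrank_end_of_isIrreducible (hirr j)
  · exact_mod_cast finrank_hom_of_isEmpty (hirr i) (hirr j) (hne i j (Ne.symm h))

lemma homTo_cl_eq_ite (hirr : ∀ i, LieModule.IsIrreducible ℂ 𝔤 (X i))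
    (hne : ∀ i j, i ≠ j → IsEmpty (X i ≃ₗ⁅ℂ, 𝔤⁆ X j)) (i j : Fin k) :
    homTo (X i) (cl 𝔤 (X j)) = if j = i then 1 else 0 := by
  rw [homTo_cl]
  split_ifs with h
  · subst h
    exact_mod_cast finrank_end_of_isIrreducible (hirr j)
  · exact_mod_cast finrank_hom_of_isEmpty (hirr j) (hirr i) (hne j i h)

lemma homFrom_sum (hirr : ∀ i, LieModule.IsIrreducible ℂ 𝔤 (X i))
    (hne : ∀ i j, i ≠ j → IsEmpty (X i ≃ₗ⁅ℂ, 𝔤⁆ X j)) (s : Fin k → ℤ) (i : Fin k) :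
    homFrom (X i) (∑ j, s j • cl 𝔤 (X j)) = s i := by
  simp [map_sum, homFrom_cl_eq_ite hirr hne]

lemma homTo_sum (hirr : ∀ i, LieModule.IsIrreducible ℂ 𝔤 (X i))
    (hne : ∀ i j, i ≠ j → IsEmpty (X i ≃ₗ⁅ℂ, 𝔤⁆ X j)) (s : Fin k → ℤ) (i : Fin k) :
    homTo (X i) (∑ j, s j • cl 𝔤 (X j)) = s i := by
  simp [map_sum, homTo_cl_eq_ite hirr hne]

/-- The images of linearly independent morphisms from irreducible representations are
independent. -/
lemma cl_sup_range (hirr : ∀ i, LieModule.IsIrreducible ℂ 𝔤 (X i))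
    (hne : ∀ i j, i ≠ j → IsEmpty (X i ≃ₗ⁅ℂ, 𝔤⁆ X j)) {κ : Fin k → Type*}
    (g : ∀ i, κ i → (X i →ₗ⁅ℂ, 𝔤⁆ U)) (hg : ∀ i, LinearIndependent ℂ (g i))
    (s : Finset (Σ i, κ i)) :
    cl 𝔤 (s.sup fun b => (g b.1 b.2).range : LieSubmodule ℂ 𝔤 U) = ∑ b ∈ s, cl 𝔤 (X b.1) := by
  classical
  induction s using Finset.induction_on with
  | empty => exact (cl_coe_congr Finset.sup_empty).trans cl_bot
  | insert b s hb ih =>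
    obtain ⟨j, b⟩ := b
    set A : LieSubmodule ℂ 𝔤 U := s.sup fun b => (g b.1 b.2).range with hA
    -- Otherwise irreducibility puts the new image inside `A`. Then `A` receives one more
    -- independent morphism from `X j` than the number of indices over `j` in `s`, whereas the
    -- induction hypothesis and Schur's lemma make that number the dimension of `hom(X j, A)`.
    have hdisj : Disjoint (g j b).range A := by
      by_contra hcon
      have hle : (g j b).range ≤ A := by
        have h1 : A.comap (g j b) ≠ ⊥ := by
          intro h0
          refine hcon (disjoint_iff.2 ((LieSubmodule.eq_bot_iff _).2 ?_))
          rintro _ ⟨⟨x, rfl⟩, hx⟩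
          have : x ∈ A.comap (g j b) := hx
          rw [h0, LieSubmodule.mem_bot] at this
          simp [this]
        have h2 := (IsSimpleOrder.eq_bot_or_eq_top (A.comap (g j b))).resolve_left h1
        rintro _ ⟨x, rfl⟩
        have : x ∈ A.comap (g j b) := h2 ▸ LieSubmodule.mem_top x
        exact this
      let T : Finset (κ j) := (insert ⟨j, b⟩ s).preimage (Sigma.mk j) sigma_mk_injective.injOn
      have hT : ∀ c ∈ T, (g j c).range ≤ A := by
        intro c hc
        rcases Finset.mem_insert.1 (Finset.mem_preimage.1 hc) with h | h
        · obtain rfl := sigma_mk_injective h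
          exact hle
        · exact Finset.le_sup (f := fun b : Σ i, κ i => (g b.1 b.2).range) h
      let φ : T → (X j →ₗ⁅ℂ, 𝔤⁆ A) := fun c =>
        (g j c).codRestrict A fun x => hT c c.2 ⟨x, rfl⟩
      have hφ : LinearIndependent ℂ φ := by
        refine LinearIndependent.of_comp (LieModuleHom.postcomp (X j) A.incl) ?_
        exact (hg j).comp _ Subtype.val_injective
      have h1 := hφ.fintype_card_le_finrank
      have h2 := homFrom_cl (𝔤 := 𝔤) (X j) A
      rw [ih, map_sum] at h2
      simp only [homFrom_cl_eq_ite hirr hne, Finset.sum_boole] at h2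
      have h3 : (s.filter fun c => c.1 = j).card = Module.finrank ℂ (X j →ₗ⁅ℂ, 𝔤⁆ A) := by
        exact_mod_cast h2
      have h4 : T.card = ((insert (⟨j, b⟩ : Σ i, κ i) s).filter fun c => c.1 = j).card := by
        rw [Finset.card_preimage]
        congr 1
        ext ⟨i, c⟩
        simp only [Finset.mem_filter, Set.mem_range, and_congr_right_iff]
        rintro -
        constructor
        · rintro ⟨y, hy⟩
          exact (congrArg Sigma.fst hy).symm
        · rintro rfl
          exact ⟨c, rfl⟩
      rw [Finset.filter_insert, if_pos rfl, Finset.card_insert_of_notMem (by simp [hb])] at h4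
      rw [Fintype.card_coe] at h1
      omega
    rw [Finset.sum_insert hb, ← ih, cl_coe_congr Finset.sup_insert, cl_sup hdisj,
      cl_range_of_injective _ (LieModuleHom.injective_of_ne_zero ((hg j).ne_zero b))]

variable (𝔤 X U) in
/-- The sum of the images of all morphisms `X i → U`. -/
noncomputable def isotypicSum : LieSubmodule ℂ 𝔤 U :=
  (Finset.univ : Finset (Σ i, Fin (Module.finrank ℂ (X i →ₗ⁅ℂ, 𝔤⁆ U)))).sup
    fun b => (Module.finBasis ℂ (X b.1 →ₗ⁅ℂ, 𝔤⁆ U) b.2).range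

lemma range_le_isotypicSum (i : Fin k) (φ : X i →ₗ⁅ℂ, 𝔤⁆ U) : φ.range ≤ isotypicSum 𝔤 X U := by
  rintro _ ⟨x, rfl⟩
  have h : φ x = ∑ c, (Module.finBasis ℂ (X i →ₗ⁅ℂ, 𝔤⁆ U)).repr φ c •
      Module.finBasis ℂ (X i →ₗ⁅ℂ, 𝔤⁆ U) c x := by
    conv_lhs => rw [← (Module.finBasis ℂ (X i →ₗ⁅ℂ, 𝔤⁆ U)).sum_repr φ]
    change LieModuleHom.toLinearMapₗ _ x = _
    rw [map_sum, LinearMap.sum_apply]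
    rfl
  rw [h]
  refine sum_mem fun c _ => SMulMemClass.smul_mem _ ?_
  exact Finset.le_sup (f := fun b : Σ i, Fin (Module.finrank ℂ (X i →ₗ⁅ℂ, 𝔤⁆ U)) =>
    (Module.finBasis ℂ (X b.1 →ₗ⁅ℂ, 𝔤⁆ U) b.2).range) (Finset.mem_univ ⟨i, c⟩) ⟨x, rfl⟩

lemma isotypicSum_le {P : LieSubmodule ℂ 𝔤 U}
    (h : ∀ i (φ : X i →ₗ⁅ℂ, 𝔤⁆ U), φ.range ≤ P) : isotypicSum 𝔤 X U ≤ P :=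
  Finset.sup_le fun _ _ => h _ _

lemma cl_isotypicSum (hirr : ∀ i, LieModule.IsIrreducible ℂ 𝔤 (X i))
    (hne : ∀ i j, i ≠ j → IsEmpty (X i ≃ₗ⁅ℂ, 𝔤⁆ X j)) :
    cl 𝔤 (isotypicSum 𝔤 X U) =
      ∑ i, (Module.finrank ℂ (X i →ₗ⁅ℂ, 𝔤⁆ U) : ℤ) • cl 𝔤 (X i) := by
  refine (cl_sup_range hirr hne _ (fun i => (Module.finBasis ℂ _).linearIndependent) _).trans ?_
  rw [Finset.univ_sigma_univ.symm, Finset.sum_sigma]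
  refine Finset.sum_congr rfl fun i _ => ?_
  change ∑ _c : Fin (Module.finrank ℂ (X i →ₗ⁅ℂ, 𝔤⁆ U)), cl 𝔤 (X i) = _
  rw [Finset.sum_const, Finset.card_univ, Fintype.card_fin, natCast_zsmul]

lemma finrank_isotypicSum (hirr : ∀ i, LieModule.IsIrreducible ℂ 𝔤 (X i))
    (hne : ∀ i j, i ≠ j → IsEmpty (X i ≃ₗ⁅ℂ, 𝔤⁆ X j)) :
    Module.finrank ℂ (isotypicSum 𝔤 X U) =
      ∑ i, Module.finrank ℂ (X i →ₗ⁅ℂ, 𝔤⁆ U) * Module.finrank ℂ (X i) := by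
  have h := congrArg (rank 𝔤) (cl_isotypicSum (U := U) hirr hne)
  simp only [map_sum, map_zsmul, rank_cl, smul_eq_mul] at h
  exact_mod_cast h

lemma finrank_hom_eq_of_cl_eq (hirr : ∀ i, LieModule.IsIrreducible ℂ 𝔤 (X i))
    (hne : ∀ i j, i ≠ j → IsEmpty (X i ≃ₗ⁅ℂ, 𝔤⁆ X j)) {n : Fin k → ℕ}
    (hU : cl 𝔤 U = ∑ i, n i • cl 𝔤 (X i)) (i : Fin k) :
    Module.finrank ℂ (X i →ₗ⁅ℂ, 𝔤⁆ U) = n i := by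
  have h := homFrom_sum hirr hne (fun i => (n i : ℤ)) i
  simp only [natCast_zsmul, ← hU, homFrom_cl] at h
  exact_mod_cast h

lemma finrank_hom_eq_of_cl_eq' (hirr : ∀ i, LieModule.IsIrreducible ℂ 𝔤 (X i))
    (hne : ∀ i j, i ≠ j → IsEmpty (X i ≃ₗ⁅ℂ, 𝔤⁆ X j)) {n : Fin k → ℕ}
    (hU : cl 𝔤 U = ∑ i, n i • cl 𝔤 (X i)) (i : Fin k) :
    Module.finrank ℂ (U →ₗ⁅ℂ, 𝔤⁆ X i) = n i := by
  have h := homTo_sum hirr hne (fun i => (n i : ℤ)) i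
  simp only [natCast_zsmul, ← hU, homTo_cl] at h
  exact_mod_cast h

/-- By dimension count: the class fixes both `dim U` and the multiplicities, and the isotypic sum
already has dimension `∑ n i * dim (X i)`. -/
lemma isotypicSum_eq_top_of_cl_eq (hirr : ∀ i, LieModule.IsIrreducible ℂ 𝔤 (X i))
    (hne : ∀ i j, i ≠ j → IsEmpty (X i ≃ₗ⁅ℂ, 𝔤⁆ X j)) {n : Fin k → ℕ}
    (hU : cl 𝔤 U = ∑ i, n i • cl 𝔤 (X i)) : isotypicSum 𝔤 X U = ⊤ := by
  have h := congrArg (rank 𝔤) hU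
  simp only [map_sum, map_nsmul, rank_cl, nsmul_eq_mul] at h
  rw [← LieSubmodule.toSubmodule_eq_top]
  refine Submodule.eq_top_of_finrank_eq ((finrank_isotypicSum hirr hne).trans ?_)
  simp only [finrank_hom_eq_of_cl_eq hirr hne hU]
  exact_mod_cast h.symm

lemma isotypicSum_range_eq_top (f : V →ₗ⁅ℂ, 𝔤⁆ W) (hV : isotypicSum 𝔤 X V = ⊤) :
    isotypicSum 𝔤 X f.range = ⊤ := by
  let p : V →ₗ⁅ℂ, 𝔤⁆ f.range := f.codRestrict f.range fun x => ⟨x, rfl⟩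
  have h : (⊤ : LieSubmodule ℂ 𝔤 V) ≤ (isotypicSum 𝔤 X f.range).comap p := by
    rw [← hV]
    refine isotypicSum_le fun i φ => ?_
    rintro _ ⟨x, rfl⟩
    exact range_le_isotypicSum i (p.comp φ) ⟨x, rfl⟩
  refine eq_top_iff.2 ?_
  rintro ⟨_, x, rfl⟩ -
  exact h (LieSubmodule.mem_top x)

/-- The multiplicity of `X i` in the image of `f` is the rank of the map induced by `f` on the
multiplicity spaces. -/
lemma finrank_range_postcomp (hirr : ∀ i, LieModule.IsIrreducible ℂ 𝔤 (X i))
    (hne : ∀ i j, i ≠ j → IsEmpty (X i ≃ₗ⁅ℂ, 𝔤⁆ X j)) (f : V →ₗ⁅ℂ, 𝔤⁆ W)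
    (hV : isotypicSum 𝔤 X V = ⊤) (i : Fin k) :
    Module.finrank ℂ (LinearMap.range (LieModuleHom.postcomp (X i) f)) =
      Module.finrank ℂ (X i →ₗ⁅ℂ, 𝔤⁆ f.range) := by
  -- Rank and nullity on each multiplicity space are bounded by the multiplicities of the image and
  -- of the kernel. Weighted by `dim (X i)` and summed, these bounds are squeezed by rank-nullity
  -- for `f`, so each bound for the image is an equality.
  have hle (i) : Module.finrank ℂ (LinearMap.range (LieModuleHom.postcomp (X i) f)) ≤
      Module.finrank ℂ (X i →ₗ⁅ℂ, 𝔤⁆ f.range) := by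
    have h : LinearMap.range (LieModuleHom.postcomp (X i) f) ≤
        LinearMap.range (LieModuleHom.postcomp (X i) f.range.incl) := by
      rintro _ ⟨φ, rfl⟩
      exact ⟨(f.codRestrict f.range fun x => ⟨x, rfl⟩).comp φ, rfl⟩
    exact (Submodule.finrank_mono h).trans (LinearMap.finrank_range_le _)
  have hker (i) : Module.finrank ℂ (LinearMap.ker (LieModuleHom.postcomp (X i) f)) ≤
      Module.finrank ℂ (X i →ₗ⁅ℂ, 𝔤⁆ f.ker) := by
    have h : LinearMap.ker (LieModuleHom.postcomp (X i) f) ≤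
        LinearMap.range (LieModuleHom.postcomp (X i) f.ker.incl) := by
      intro φ hφ
      refine ⟨φ.codRestrict f.ker fun x => ?_, rfl⟩
      rw [LieModuleHom.mem_ker]
      exact LieModuleHom.congr_fun hφ x
    exact (Submodule.finrank_mono h).trans (LinearMap.finrank_range_le _)
  have hn (i) := LinearMap.finrank_range_add_finrank_ker (LieModuleHom.postcomp (X i) f)
  have hK : ∑ i, Module.finrank ℂ (X i →ₗ⁅ℂ, 𝔤⁆ f.ker) * Module.finrank ℂ (X i) ≤
      Module.finrank ℂ f.ker := by
    rw [← finrank_isotypicSum hirr hne]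
    exact Submodule.finrank_le (isotypicSum 𝔤 X f.ker : Submodule ℂ f.ker)
  have htop {Y : Type v} [AddCommGroup Y] [Module ℂ Y] [LieRingModule 𝔤 Y] [LieModule ℂ 𝔤 Y]
      [FiniteDimensional ℂ Y] (h : isotypicSum 𝔤 X Y = ⊤) : Module.finrank ℂ Y =
        ∑ i, Module.finrank ℂ (X i →ₗ⁅ℂ, 𝔤⁆ Y) * Module.finrank ℂ (X i) := by
    rw [← finrank_isotypicSum hirr hne, h]
    exact (finrank_top ℂ Y).symm
  have hVd := htop hV
  have hRd := htop (isotypicSum_range_eq_top f hV)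
  have hrn : Module.finrank ℂ f.range + Module.finrank ℂ f.ker = Module.finrank ℂ V :=
    LinearMap.finrank_range_add_finrank_ker (f : V →ₗ[ℂ] W)
  have hpos : 0 < Module.finrank ℂ (X i) := by
    have := LieModule.nontrivial_of_isIrreducible ℂ 𝔤 (X i)
    exact Module.finrank_pos
  have h1 : ∑ i, Module.finrank ℂ (X i →ₗ⁅ℂ, 𝔤⁆ V) * Module.finrank ℂ (X i) ≤
      ∑ i, Module.finrank ℂ (LinearMap.range (LieModuleHom.postcomp (X i) f)) *
        Module.finrank ℂ (X i) +
      ∑ i, Module.finrank ℂ (X i →ₗ⁅ℂ, 𝔤⁆ f.ker) * Module.finrank ℂ (X i) := by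
    rw [← Finset.sum_add_distrib]
    refine Finset.sum_le_sum fun i _ => ?_
    rw [← add_mul, ← hn i]
    exact Nat.mul_le_mul_right _ (Nat.add_le_add_left (hker i) _)
  have h2 : ∀ j ∈ Finset.univ,
      Module.finrank ℂ (LinearMap.range (LieModuleHom.postcomp (X j) f)) *
        Module.finrank ℂ (X j) ≤
      Module.finrank ℂ (X j →ₗ⁅ℂ, 𝔤⁆ f.range) * Module.finrank ℂ (X j) :=
    fun j _ => Nat.mul_le_mul_right _ (hle j)
  have h3 := (Finset.sum_eq_sum_iff_of_le h2).1
    (le_antisymm (Finset.sum_le_sum h2) (by omega)) i (Finset.mem_univ i)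
  exact Nat.eq_of_mul_eq_mul_right hpos h3

lemma gRank_eq_iff (hirr : ∀ i, LieModule.IsIrreducible ℂ 𝔤 (X i))
    (hne : ∀ i j, i ≠ j → IsEmpty (X i ≃ₗ⁅ℂ, 𝔤⁆ X j)) (f : V →ₗ⁅ℂ, 𝔤⁆ W)
    (hV : isotypicSum 𝔤 X V = ⊤) (s : Fin k → ℤ) :
    gRank f = ∑ i, s i • cl 𝔤 (X i) ↔ ∀ i,
      (Module.finrank ℂ (LinearMap.range (LieModuleHom.postcomp (X i) f)) : ℤ) = s i := by
  simp only [finrank_range_postcomp hirr hne f hV]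
  constructor
  · intro h i
    rw [← homFrom_cl, ← homFrom_sum hirr hne s i, ← h, gRank]
  · intro h
    rw [gRank, ← cl_top, ← cl_coe_congr (isotypicSum_range_eq_top f hV), cl_isotypicSum hirr hne]
    simp only [h]

variable (𝔤 X V W) in
/-- The action of the morphisms `V → W` on the multiplicity spaces. -/
def multiplicityMap : (V →ₗ⁅ℂ, 𝔤⁆ W) →ₗ[ℂ]
    ∀ i, (X i →ₗ⁅ℂ, 𝔤⁆ V) →ₗ[ℂ] (X i →ₗ⁅ℂ, 𝔤⁆ W) :=
  LinearMap.pi fun i => LieModuleHom.postcomp (X i)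

lemma multiplicityMap_injective (hV : isotypicSum 𝔤 X V = ⊤) :
    Function.Injective (multiplicityMap 𝔤 X V W) := by
  rw [← LinearMap.ker_eq_bot, LinearMap.ker_eq_bot']
  intro f hf
  have h : isotypicSum 𝔤 X V ≤ f.ker := by
    refine isotypicSum_le fun i φ => ?_
    rintro _ ⟨x, rfl⟩
    rw [LieModuleHom.mem_ker]
    exact LieModuleHom.congr_fun (LinearMap.congr_fun (congrFun hf i) φ) x
  ext x
  exact LieModuleHom.mem_ker.1 (h (hV ▸ LieSubmodule.mem_top x))

/-- Additivity in `W` reduces to `dim hom(V, X i)`, and additivity in `V`, through `homTo`, gives `n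
i` for it. -/
lemma finrank_hom_of_cl_eq (hirr : ∀ i, LieModule.IsIrreducible ℂ 𝔤 (X i))
    (hne : ∀ i j, i ≠ j → IsEmpty (X i ≃ₗ⁅ℂ, 𝔤⁆ X j)) {n m : Fin k → ℕ}
    (hV : cl 𝔤 V = ∑ i, n i • cl 𝔤 (X i)) (hW : cl 𝔤 W = ∑ i, m i • cl 𝔤 (X i)) :
    Module.finrank ℂ (V →ₗ⁅ℂ, 𝔤⁆ W) = ∑ i, n i * m i := by
  have h := congrArg (homFrom V) hW
  simp only [map_sum, map_nsmul, homFrom_cl, finrank_hom_eq_of_cl_eq' hirr hne hV,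
    nsmul_eq_mul] at h
  simp only [mul_comm (n _)]
  exact_mod_cast h

/-- The decomposition of `hom_𝔤(V, W)` into the spaces of linear maps between the multiplicity
spaces, in coordinates. -/
theorem exists_equiv_homRank (hirr : ∀ i, LieModule.IsIrreducible ℂ 𝔤 (X i))
    (hne : ∀ i j, i ≠ j → IsEmpty (X i ≃ₗ⁅ℂ, 𝔤⁆ X j)) {n m : Fin k → ℕ} (s : Fin k → ℤ)
    (hV : cl 𝔤 V = ∑ i, n i • cl 𝔤 (X i)) (hW : cl 𝔤 W = ∑ i, m i • cl 𝔤 (X i)) :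
    ∃ Φ : (V →ₗ⁅ℂ, 𝔤⁆ W) ≃ₗ[ℂ] (∀ i, (Fin (n i) → ℂ) →ₗ[ℂ] (Fin (m i) → ℂ)),
      homRank V W (∑ i, s i • cl 𝔤 (X i)) =
        Φ ⁻¹' Set.univ.pi fun i => detVariety (n i) (m i) (s i) := by
  have hVt := isotypicSum_eq_top_of_cl_eq hirr hne hV
  have hnV := finrank_hom_eq_of_cl_eq hirr hne hV
  have hmW := finrank_hom_eq_of_cl_eq hirr hne hW
  let P := LinearEquiv.ofInjectiveOfFinrankEq (multiplicityMap 𝔤 X V W)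
    (multiplicityMap_injective hVt) (by
      rw [finrank_hom_of_cl_eq hirr hne hV hW, Module.finrank_pi_fintype]
      simp only [Module.finrank_linearMap, hnV, hmW])
  let b : ∀ i, (X i →ₗ⁅ℂ, 𝔤⁆ V) ≃ₗ[ℂ] (Fin (n i) → ℂ) := fun i =>
    LinearEquiv.ofFinrankEq _ _ (by simp [hnV])
  let c : ∀ i, (X i →ₗ⁅ℂ, 𝔤⁆ W) ≃ₗ[ℂ] (Fin (m i) → ℂ) := fun i =>
    LinearEquiv.ofFinrankEq _ _ (by simp [hmW])
  refine ⟨P.trans (LinearEquiv.piCongrRight fun i => (b i).arrowCongr (c i)), ?_⟩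
  ext f
  refine (gRank_eq_iff hirr hne f hVt s).trans ?_
  simp only [Set.mem_preimage, Set.mem_univ_pi]
  refine forall_congr' fun i => ?_
  have h : (P.trans (LinearEquiv.piCongrRight fun i => (b i).arrowCongr (c i))) f i =
      (c i).toLinearMap ∘ₗ LieModuleHom.postcomp (X i) f ∘ₗ (b i).symm.toLinearMap := rfl
  rw [h, detVariety, Set.mem_ofPred_eq, LinearMap.range_comp, LinearEquiv.finrank_map_eq,
    LinearEquiv.range_comp]

end

/-! ### Conclusion in matrix coordinates -/

lemma toMatrix'_mem_rankSet {n m r : ℕ} (f : (Fin n → ℂ) →ₗ[ℂ] (Fin m → ℂ)) :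
    LinearMap.toMatrix' f ∈ Zar.rankSet m n r ↔ f ∈ detVariety n m r := by
  rw [Zar.rankSet, detVariety, Set.mem_ofPred_eq, Set.mem_ofPred_eq, Matrix.rank,
    ← Matrix.toLin'_apply', Matrix.toLin'_toMatrix', Nat.cast_inj]

theorem proposition25
    {𝔤 : Type u} [LieRing 𝔤] [LieAlgebra ℂ 𝔤] [FiniteDimensional ℂ 𝔤]
    [LieAlgebra.IsSemisimple ℂ 𝔤]
    -- pairwise non-isomorphic irreducible representations
    {k : ℕ} (X : Fin k → Type v)
    [∀ i, AddCommGroup (X i)] [∀ i, Module ℂ (X i)] [∀ i, LieRingModule 𝔤 (X i)]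
    [∀ i, LieModule ℂ 𝔤 (X i)] [∀ i, FiniteDimensional ℂ (X i)]
    (hirr : ∀ i, LieModule.IsIrreducible ℂ 𝔤 (X i))
    (hne : ∀ i j, i ≠ j → IsEmpty (X i ≃ₗ⁅ℂ, 𝔤⁆ X j))
    (V W : Type v)
    [AddCommGroup V] [Module ℂ V] [LieRingModule 𝔤 V] [LieModule ℂ 𝔤 V] [FiniteDimensional ℂ V]
    [AddCommGroup W] [Module ℂ W] [LieRingModule 𝔤 W] [LieModule ℂ 𝔤 W] [FiniteDimensional ℂ W]
    (n m : Fin k → ℕ) (s : Fin k → ℤ) (S : RepRing.{u, v} 𝔤)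
    (hV : cl 𝔤 V = ∑ i, n i • cl 𝔤 (X i))
    (hW : cl 𝔤 W = ∑ i, m i • cl 𝔤 (X i))
    (hS : S = ∑ i, s i • cl 𝔤 (X i))
    (hS0 : 0 ≤ S) (hSV : S ≤ cl 𝔤 V) (hSW : S ≤ cl 𝔤 W) :
    Zar.IsLocClosed (homRank V W S) ∧
    Zar.IsIrred (homRank V W S) ∧
    Zar.IsSmooth (homRank V W S) ∧
    (∃ d : ℕ, Zar.dim (homRank V W S) = (d : WithBot ℕ∞) ∧
      (d : ℤ) = ∑ i, ((n i : ℤ) + m i - s i) * s i) ∧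
    -- the product decomposition, by a linear isomorphism of the ambient spaces
    (∃ Φ : (V →ₗ⁅ℂ, 𝔤⁆ W) ≃ₗ[ℂ] (∀ i, (Fin (n i) → ℂ) →ₗ[ℂ] (Fin (m i) → ℂ)),
      Φ '' homRank V W S = Set.univ.pi fun i => detVariety (n i) (m i) (s i)) := by
  -- `homFrom (X i)` is monotone and reads off the `i`-th coefficient, so the order relations in the
  -- representation ring become `0 ≤ s i ≤ min (n i) (m i)`.
  have hs0 (i) : 0 ≤ s i := by
    have h := RepRing.homFrom_mono (X i) hS0
    rwa [map_zero, hS, homFrom_sum hirr hne] at h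
  have hsn (i) : s i ≤ n i := by
    have h := RepRing.homFrom_mono (X i) hSV
    rwa [hS, homFrom_sum hirr hne, RepRing.homFrom_cl,
      finrank_hom_eq_of_cl_eq hirr hne hV] at h
  have hsm (i) : s i ≤ m i := by
    have h := RepRing.homFrom_mono (X i) hSW
    rwa [hS, homFrom_sum hirr hne, RepRing.homFrom_cl,
      finrank_hom_eq_of_cl_eq hirr hne hW] at h
  lift s to Fin k → ℕ using hs0
  obtain ⟨Φ, hΦ⟩ := exists_equiv_homRank hirr hne (fun i => (s i : ℤ)) hV hW
  rw [← hS] at hΦ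
  let e := Φ.trans (LinearEquiv.piCongrRight fun i =>
    (LinearMap.toMatrix' : ((Fin (n i) → ℂ) →ₗ[ℂ] (Fin (m i) → ℂ)) ≃ₗ[ℂ] _))
  have hX : homRank V W S = e ⁻¹' Set.univ.pi fun i => Zar.rankSet (m i) (n i) (s i) := by
    rw [hΦ]
    ext f
    simp only [Set.mem_preimage, Set.mem_univ_pi]
    exact forall_congr' fun i => (toMatrix'_mem_rankSet _).symm
  have hn (i) : s i ≤ n i := Int.ofNat_le.1 (hsn i)
  have hm (i) : s i ≤ m i := Int.ofNat_le.1 (hsm i)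
  obtain ⟨h1, h2, h3, h4⟩ := Zar.geometry_of_rankSets e hm hn hX
  refine ⟨h1, h2, h3, ⟨_, h4, ?_⟩, Φ, by rw [hΦ, Set.image_preimage_eq _ Φ.surjective]⟩
  rw [Nat.cast_sum]
  refine Finset.sum_congr rfl fun i _ => ?_
  -- The natural subtraction is genuine because `s i * s i ≤ m i * s i`.
  rw [Nat.cast_sub ((Nat.mul_le_mul_right _ (hm i)).trans (Nat.le_add_right _ _))]
  push_cast
  ring
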